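/- For a prime $p>3$, identify $\mathbb F_p$ with $\{0,\pm1,\dots,\pm(p-1)/2\}$, and for $a,b\in\mathbb F_p$ with $4a^3+27b^2\ne0$ let $\mathbf E_{a,b}$ be the elliptic curve $Y^2=X^3+aX+b$ over $\mathbb F_p$. Put $d_p=\gcd(p-1,6)$, $e_p=\gcd(p-1,4)$ and, for a positive integer $M$, $$\sigma_p(M)=\max_{\substack{\chi\ne\chi_0\\ \chi^{d_p}=\chi_0}}\Bigl\{1,\ \Bigl|\sum_{n=1}^{M}\chi(n)\Bigr|\Bigr\},\qquad \rho_p(M)=\max_{\substack{\chi\ne\chi_0\\ \chi^{e_p}=\chi_0}}\Bigl\{1,\ \Bigl|\sum_{n=1}^{M}\chi(n)\Bigr|\Bigr\},$$ where $\chi$ runs through the multiplicative characters of $\mathbb F_p$ and $\chi_0$ is the principal one. Define $$\mathcal E_1(A,B;p)=\min\bigl\{A\,\sigma_p(B)+A^{1/2}Bp^{1/4}+A^{1/2}B^{1/2}p^{1/2},\ B\,\rho_p(A)+AB^{1/2}p^{1/4}+A^{1/2}B^{1/2}p^{1/2}\bigr\},$$ $$\mathcal E_2(A,B;p)=\min\bigl\{A\,\sigma_p(B)+B^{1/2}p\log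 p,\ B\,\rho_p(A)+A^{1/2}p\log p\bigr\}.$$ For $\mathcal S\subseteq\mathbb F_p\times\mathbb F_p$ let $M_p(\mathcal S,A,B)$ be the number of pairs $(a,b)\in\mathcal S$ with $|a|\le A$ and $|b|\le B$. Theorem. There exist an absolute constant $c>0$ and a function $g:\mathbb N\to\mathbb R$ with $g(p)\to0$ as $p\to\infty$ such that for all primes $p>3$, all integers $1\le A,B\le(p-1)/2$, and all sets $\mathcal S\subseteq\mathbb F_p\times\mathbb F_p$ with the property that $(a,b)\in\mathcal S$ whenever $(r,s)\in\mathcal S$ and $\mathbf E_{a,b}$, $\mathbf E_{r,s}$ are elliptic curves isomorphic over $\mathbb F_p$, one has $$\Bigl|M_p(\mathcal S,A,B)-\frac{4AB}{p^2}\,\#\mathcal S\Bigr|\le c\,\min\bigl\{\mathcal E_1(A,B;p)\,p^{g(p)},\ \mathcal E_2(A,B;p)\bigr\}.$$ -/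

import Mathlib

open Filter Topology

noncomputable section

namespace SmallHeight

/-- The Weierstrass curve `Y² = X³ + aX + b` over a commutative ring. -/
def curve {R : Type*} [CommRing R] (a b : R) : WeierstrassCurve R :=
  ⟨0, 0, 0, a, b⟩

/-- `E_{a,b}` and `E_{r,s}` are elliptic curves over `R` (unit discriminant) that are isomorphic
over `R`, that is, related by an admissible change of variables
`(X, Y) ↦ (u²X + ρ, u³Y + σu²X + τ)` with coefficients in `R` and `u` a unit. -/
def Isomorphic {R : Type*} [CommRing R] (a b r s : R) : Prop :=
  (curve a b).IsElliptic ∧ (curve r s).IsElliptic ∧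
    ∃ C : WeierstrassCurve.VariableChange R, C • curve r s = curve a b

/-- A set of pairs `(a, b)` is closed under isomorphism over `𝔽_p` of the curves `E_{a,b}`. -/
def IsoClosed {p : ℕ} (S : Finset (ZMod p × ZMod p)) : Prop :=
  ∀ a b r s : ZMod p, (r, s) ∈ S → Isomorphic a b r s → (a, b) ∈ S

/-- `M_p(S, A, B)`: the number of `(a, b) ∈ S` with `|a| ≤ A` and `|b| ≤ B`, where an element of
`𝔽_p` is identified with its representative in `{0, ±1, …, ±(p-1)/2}`. -/
def boxCount {p : ℕ} (S : Finset (ZMod p × ZMod p)) (A B : ℕ) : ℕ :=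
  (S.filter fun x => |x.1.valMinAbs| ≤ (A : ℤ) ∧ |x.2.valMinAbs| ≤ (B : ℤ)).card

/-- The set consisting of `1` and of the absolute values `|χ(1) + ⋯ + χ(M)|`, where `χ` runs
through the nonprincipal multiplicative characters of `𝔽_p` with `χ ^ d` principal. -/
def charSumValues (p d M : ℕ) : Set ℝ :=
  insert 1 {x : ℝ | ∃ χ : MulChar (ZMod p) ℂ, χ ≠ 1 ∧ χ ^ d = 1 ∧
    x = ‖∑ n ∈ Finset.Icc 1 M, χ (n : ZMod p)‖}

/-- The maximum of `charSumValues p d M`. -/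
def charSumMax (p d M : ℕ) : ℝ := sSup (charSumValues p d M)

/-- For a prime `p` the supremum is a maximum of a finite set. -/
theorem isGreatest_charSumMax (p d M : ℕ) [Fact p.Prime] :
    IsGreatest (charSumValues p d M) (charSumMax p d M) := by
  have hfin : (charSumValues p d M).Finite := by
    refine Set.Finite.insert 1 (Set.Finite.subset (Set.finite_range
      fun χ : MulChar (ZMod p) ℂ => ‖∑ n ∈ Finset.Icc 1 M, χ (n : ZMod p)‖) ?_)
    rintro x ⟨χ, -, -, rfl⟩
    exact ⟨χ, rfl⟩
  have hne : (charSumValues p d M).Nonempty := ⟨1, Set.mem_insert 1 _⟩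
  exact ⟨hne.csSup_mem hfin, fun x hx => le_csSup hfin.bddAbove hx⟩

/-- `σ_p(M)`, with characters of order dividing `gcd(p-1, 6)`. -/
def sigma (p M : ℕ) : ℝ := charSumMax p (Nat.gcd (p - 1) 6) M

/-- `ρ_p(M)`, with characters of order dividing `gcd(p-1, 4)`. -/
def rho (p M : ℕ) : ℝ := charSumMax p (Nat.gcd (p - 1) 4) M

/-- `ℰ₁(A, B; p)`. -/
def errorOne (A B p : ℕ) : ℝ :=
  min
    ((A : ℝ) * sigma p B + (A : ℝ) ^ (1 / 2 : ℝ) * (B : ℝ) * (p : ℝ) ^ (1 / 4 : ℝ)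
      + (A : ℝ) ^ (1 / 2 : ℝ) * (B : ℝ) ^ (1 / 2 : ℝ) * (p : ℝ) ^ (1 / 2 : ℝ))
    ((B : ℝ) * rho p A + (A : ℝ) * (B : ℝ) ^ (1 / 2 : ℝ) * (p : ℝ) ^ (1 / 4 : ℝ)
      + (A : ℝ) ^ (1 / 2 : ℝ) * (B : ℝ) ^ (1 / 2 : ℝ) * (p : ℝ) ^ (1 / 2 : ℝ))

/-- `ℰ₂(A, B; p)`. -/
def errorTwo (A B p : ℕ) : ℝ :=
  min
    ((A : ℝ) * sigma p B + (B : ℝ) ^ (1 / 2 : ℝ) * (p : ℝ) * Real.log (p : ℝ))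
    ((B : ℝ) * rho p A + (A : ℝ) ^ (1 / 2 : ℝ) * (p : ℝ) * Real.log (p : ℝ))

end SmallHeight

end

/-! The isomorphisms (a, b) ↦ (u⁴a, u⁶b) are the only ones needed. Discarding pairs with ab = 0 or
vanishing discriminant costs O(A + B) and leaves a set stable under this action of the unit group.
Expanding the box count in pairs of multiplicative characters (`sum_pairTransform_mul_boxSum`),
stability forces the transform of the set to vanish unless χ₁⁴χ₂⁶ = 1
(`pow_mul_pow_eq_one_of_pairTransform_ne_zero`).

The pair (1, 1) gives the main term. The pairs (1, χ₂) have χ₂⁶ = 1; they are boundedly many and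
give A σ(B) trivially. For the rest, Cauchy–Schwarz and Parseval for the set
(`sum_norm_sq_pairTransform_le`) leave the square root of ∑ |χ₁-sum to A|² |χ₂-sum to B|². The
character group is cyclic, so each component determines the other up to boundedly many choices, and
the two can be treated separately.

Pólya–Vinogradov for χ₁ and the mean square for χ₂ give one half of ℰ₂. A second Cauchy–Schwarz and
the fourth moment p^{1+o(1)} M² over nonprincipal characters (`sum_norm_pow_four_charSum_le`) give
one half of ℰ₁; a principal χ₂ adds B⁴ and causes the term A^{1/2} B p^{1/4}. Exchanging the
coordinates, and the exponents 4 and 6, gives the other halves. -/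

noncomputable section

namespace SmallHeight

/-! ### The divisor bound and the subpolynomial loss -/

/-- The divisor function is `O(n ^ ε)` for every `ε > 0`. -/
theorem exists_card_divisors_le_rpow {ε : ℝ} (hε : 0 < ε) :
    ∃ C : ℝ, 1 ≤ C ∧ ∀ n : ℕ, n ≠ 0 → (n.divisors.card : ℝ) ≤ C * (n : ℝ) ^ ε := by
  have hl : 0 < ε * Real.log 2 := mul_pos hε (Real.log_pos one_lt_two)
  -- A prime q ≥ 2^{1/ε} has k + 1 ≤ 2^k ≤ q^{kε} and costs nothing. Each of the at most N smaller
  -- primes costs K, chosen so that K(1 + kε log 2) ≥ k + 1.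
  set K : ℝ := 1 + 1 / (ε * Real.log 2) with hK
  have hK1 : 1 ≤ K := by
    have : 0 ≤ 1 / (ε * Real.log 2) := by positivity
    linarith
  obtain ⟨N, hN⟩ := exists_nat_ge ((2 : ℝ) ^ (1 / ε))
  refine ⟨K ^ N, one_le_pow₀ hK1, fun n hn => ?_⟩
  have hfac : (n : ℝ) ^ ε = ∏ q ∈ n.primeFactors, ((q : ℝ) ^ n.factorization q) ^ ε := by
    rw [Real.finsetProd_rpow _ _ (fun q _ => by positivity)]
    conv_lhs => rw [← Nat.prod_factorization_pow_eq_self hn]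
    simp [Finsupp.prod]
  have hc : ∏ q ∈ n.primeFactors, (if q < N then K else 1) ≤ K ^ N := by
    rw [Finset.prod_ite, Finset.prod_const, Finset.prod_const_one, mul_one]
    refine pow_le_pow_right₀ hK1 ?_
    calc _ ≤ (Finset.range N).card := Finset.card_le_card fun q hq => by
            simpa using (Finset.mem_filter.1 hq).2
      _ = N := Finset.card_range N
  rw [Nat.card_divisors hn, hfac]
  push_cast
  calc ∏ q ∈ n.primeFactors, ((n.factorization q : ℝ) + 1)
      ≤ ∏ q ∈ n.primeFactors,
          ((if q < N then K else 1) * ((q : ℝ) ^ n.factorization q) ^ ε) := by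
        refine Finset.prod_le_prod (fun _ _ => by positivity) fun q hq => ?_
        have hq2 : (2 : ℝ) ≤ q := by exact_mod_cast (Nat.prime_of_mem_primeFactors hq).two_le
        set k := n.factorization q
        have e : ((q : ℝ) ^ k) ^ ε = ((q : ℝ) ^ ε) ^ k := by
          rw [← Real.rpow_natCast, ← Real.rpow_natCast, ← Real.rpow_mul (by positivity),
            ← Real.rpow_mul (by positivity), mul_comm]
        split_ifs with h
        · have h2 : 1 + k * (ε * Real.log 2) ≤ ((q : ℝ) ^ k) ^ ε := by
            calc 1 + k * (ε * Real.log 2) ≤ Real.exp (k * (ε * Real.log 2)) := by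
                  linarith [Real.add_one_le_exp (k * (ε * Real.log 2))]
              _ = ((2 : ℝ) ^ k) ^ ε := by
                  rw [← Real.rpow_natCast, ← Real.rpow_mul (by positivity),
                    Real.rpow_def_of_pos (by positivity)]
                  ring_nf
              _ ≤ _ := by gcongr
          refine le_trans ?_ (mul_le_mul_of_nonneg_left h2 (by linarith))
          have : K * (1 + k * (ε * Real.log 2)) = 1 + k + 1 / (ε * Real.log 2)
              + k * (ε * Real.log 2) := by
            rw [hK]; field_simp; ring
          rw [this]
          have h3 : 0 ≤ 1 / (ε * Real.log 2) := by positivity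
          have h4 : 0 ≤ k * (ε * Real.log 2) := by positivity
          linarith
        · rw [one_mul, e]
          have h2 : (2 : ℝ) ≤ (q : ℝ) ^ ε := by
            calc (2 : ℝ) = ((2 : ℝ) ^ (1 / ε)) ^ ε := by
                  rw [← Real.rpow_mul (by norm_num), one_div_mul_cancel hε.ne', Real.rpow_one]
              _ ≤ (q : ℝ) ^ ε := by
                  gcongr
                  exact hN.trans (by exact_mod_cast not_lt.1 h)
          calc (k : ℝ) + 1 ≤ 2 ^ k := by exact_mod_cast Nat.lt_two_pow_self
            _ ≤ _ := by gcongr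
    _ = (∏ q ∈ n.primeFactors, (if q < N then K else 1)) *
          ∏ q ∈ n.primeFactors, ((q : ℝ) ^ n.factorization q) ^ ε := Finset.prod_mul_distrib
    _ ≤ _ := by gcongr

/-- The largest number of divisors of an integer up to `p ^ 2`. -/
def maxDivisors (p : ℕ) : ℕ := (Finset.Icc 1 (p ^ 2)).sup fun m => m.divisors.card

theorem card_divisors_le_maxDivisors {p m : ℕ} (h1 : m ≠ 0) (h2 : m ≤ p ^ 2) :
    m.divisors.card ≤ maxDivisors p :=
  Finset.le_sup (f := fun m : ℕ => m.divisors.card)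
    (Finset.mem_Icc.2 ⟨Nat.one_le_iff_ne_zero.2 h1, h2⟩)

theorem one_le_maxDivisors {p : ℕ} (hp : p ≠ 0) : 1 ≤ maxDivisors p := by
  simpa using card_divisors_le_maxDivisors (p := p) one_ne_zero
    (Nat.one_le_iff_ne_zero.2 (pow_ne_zero 2 hp))

/-- The subpolynomial factor occurring in the fourth moment of character sums. -/
def lossFactor (p : ℕ) : ℝ := (maxDivisors p : ℝ) ^ 2 * (1 + Real.log p) ^ 2

theorem one_le_lossFactor {p : ℕ} (hp : p ≠ 0) : 1 ≤ lossFactor p := by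
  have h1 : (1 : ℝ) ≤ maxDivisors p := by exact_mod_cast one_le_maxDivisors hp
  have h2 : (1 : ℝ) ≤ 1 + Real.log p := by
    have := Real.log_natCast_nonneg p
    linarith
  exact one_le_mul_of_one_le_of_one_le (one_le_pow₀ h1) (one_le_pow₀ h2)

theorem exists_lossFactor_le_rpow {ε : ℝ} (hε : 0 < ε) :
    ∃ C : ℝ, 1 ≤ C ∧ ∀ p : ℕ, p ≠ 0 → lossFactor p ≤ C * (p : ℝ) ^ ε := by
  -- For integers up to p², exponent ε/8 becomes p^{ε/4}. The loss is a product of four factors of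
  -- this size: two from divisors, two from logarithms.
  obtain ⟨C, hC1, hC⟩ := exists_card_divisors_le_rpow (ε := ε / 8) (by positivity)
  refine ⟨C ^ 2 * (1 + 4 / ε) ^ 2, ?_, fun p hp => ?_⟩
  · refine one_le_mul_of_one_le_of_one_le (one_le_pow₀ hC1) (one_le_pow₀ ?_)
    have : 0 < 4 / ε := by positivity
    linarith
  have hp1 : (1 : ℝ) ≤ p := by exact_mod_cast Nat.one_le_iff_ne_zero.2 hp
  have hp0 : (0 : ℝ) < p := by linarith
  have h1 : (maxDivisors p : ℝ) ≤ C * (p : ℝ) ^ (ε / 4) := by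
    obtain ⟨m, hm, he⟩ := Finset.exists_mem_eq_sup (Finset.Icc 1 (p ^ 2))
      (Finset.nonempty_Icc.2 (Nat.one_le_iff_ne_zero.2 (pow_ne_zero 2 hp)))
      (fun m : ℕ => m.divisors.card)
    rw [maxDivisors, he]
    obtain ⟨hm1, hm2⟩ := Finset.mem_Icc.1 hm
    refine (hC m (by omega)).trans ?_
    gcongr
    calc (m : ℝ) ^ (ε / 8) ≤ ((p : ℝ) ^ 2) ^ (ε / 8) := by
          gcongr
          exact_mod_cast hm2
      _ = (p : ℝ) ^ (ε / 4) := by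
          rw [← Real.rpow_natCast, ← Real.rpow_mul hp0.le]
          norm_num
          ring_nf
  have h2 : 1 + Real.log p ≤ (1 + 4 / ε) * (p : ℝ) ^ (ε / 4) := by
    have := Real.log_le_rpow_div hp0.le (ε := ε / 4) (by positivity)
    have h3 : 1 ≤ (p : ℝ) ^ (ε / 4) := Real.one_le_rpow hp1 (by positivity)
    have h4 : (p : ℝ) ^ (ε / 4) / (ε / 4) = 4 / ε * (p : ℝ) ^ (ε / 4) := by field_simp
    rw [h4] at this
    linarith
  have h0 : 0 ≤ 1 + Real.log p := by
    have := Real.log_natCast_nonneg p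
    linarith
  calc lossFactor p ≤ (C * (p : ℝ) ^ (ε / 4)) ^ 2 * ((1 + 4 / ε) * (p : ℝ) ^ (ε / 4)) ^ 2 := by
        unfold lossFactor
        gcongr
    _ = C ^ 2 * (1 + 4 / ε) ^ 2 * ((p : ℝ) ^ (ε / 4)) ^ 4 := by ring
    _ = _ := by
        rw [← Real.rpow_natCast ((p : ℝ) ^ (ε / 4)) 4, ← Real.rpow_mul hp0.le]
        norm_num

/-- The exponent `g` with `p ^ g p = lossFactor p`. -/
def lossExponent (p : ℕ) : ℝ := Real.log (lossFactor p) / Real.log p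

theorem rpow_lossExponent {p : ℕ} (hp : 1 < p) : (p : ℝ) ^ lossExponent p = lossFactor p := by
  have hp1 : (1 : ℝ) < p := by exact_mod_cast hp
  have h := one_le_lossFactor (p := p) (by omega)
  rw [Real.rpow_def_of_pos (by linarith), lossExponent,
    mul_div_cancel₀ _ (Real.log_pos hp1).ne', Real.exp_log (by linarith)]

theorem tendsto_lossExponent : Tendsto lossExponent atTop (𝓝 0) := by
  rw [Metric.tendsto_atTop]
  intro ε hε
  -- The exponent is at most log C / log p + ε/2, and the first summand is below ε/2 once log p > 2
  -- log C / ε.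
  obtain ⟨C, hC1, hC⟩ := exists_lossFactor_le_rpow (ε := ε / 2) (by positivity)
  have ht : Tendsto (fun n : ℕ => Real.log n) atTop atTop :=
    Real.tendsto_log_atTop.comp tendsto_natCast_atTop_atTop
  obtain ⟨N, hN⟩ := eventually_atTop.1 (ht.eventually_gt_atTop (2 * Real.log C / ε))
  refine ⟨max N 2, fun p hp => ?_⟩
  have hp2 : 2 ≤ p := (le_max_right _ _).trans hp
  have hp1 : (1 : ℝ) < p := by exact_mod_cast hp2
  have hlog := Real.log_pos hp1
  have h1 := one_le_lossFactor (p := p) (by omega)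
  have hg : 0 ≤ lossExponent p := div_nonneg (Real.log_nonneg h1) hlog.le
  rw [Real.dist_eq, sub_zero, abs_of_nonneg hg, lossExponent, div_lt_iff₀ hlog]
  have h2 := Real.log_le_log (by linarith) (hC p (by omega))
  rw [Real.log_mul (by linarith) (by positivity), Real.log_rpow (by linarith)] at h2
  have h3 := hN p ((le_max_left _ _).trans hp)
  rw [div_lt_iff₀ hε] at h3
  linarith

/-! ### Parseval and moments of multiplicative character sums -/

/-- The positive integers up to `N` in the residue class `t` modulo `p`. -/
def residueClass (p N : ℕ) (t : ZMod p) : Finset ℕ :=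
  (Finset.Icc 1 N).filter fun m : ℕ => (m : ZMod p) = t

section Moments

variable {p : ℕ} [Fact p.Prime]

/-- Orthogonality of the p - 1 characters. The case s = 0 is separate because every character, the
principal one included, vanishes there. -/
theorem sum_inv_char_mul_char (s t : ZMod p) :
    ∑ χ : DirichletCharacter ℂ p, χ⁻¹ s * χ t = if s ≠ 0 ∧ s = t then ((p : ℂ) - 1) else 0 := by
  have hp : p.Prime := Fact.out
  simp only [MulChar.inv_apply']
  by_cases hs : s = 0
  · simp [hs, MulChar.map_zero]
  · rw [DirichletCharacter.sum_char_inv_mul_char_eq ℂ (isUnit_iff_ne_zero.2 hs) t,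
      Nat.totient_prime hp, Nat.cast_sub hp.one_le]
    simp [hs]

/-- The mean square of a multiplicative transform is bounded by the Parseval identity. -/
theorem sum_norm_sq_charTransform_le (f : ZMod p → ℂ) :
    ∑ χ : DirichletCharacter ℂ p, ‖∑ t, χ t * f t‖ ^ 2 ≤ ((p : ℝ) - 1) * ∑ t, ‖f t‖ ^ 2 := by
  have hp : p.Prime := Fact.out
  have hp1 : (1 : ℝ) ≤ p := by exact_mod_cast hp.one_le
  have key : ((∑ χ : DirichletCharacter ℂ p, ‖∑ t, χ t * f t‖ ^ 2 : ℝ) : ℂ) =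
      ((∑ s : ZMod p, if s ≠ 0 then ((p : ℝ) - 1) * ‖f s‖ ^ 2 else 0 : ℝ) : ℂ) := by
    push_cast
    calc ∑ χ : DirichletCharacter ℂ p, (‖∑ t, χ t * f t‖ : ℂ) ^ 2
        = ∑ χ : DirichletCharacter ℂ p, ∑ s, ∑ t, (star (f s) * f t) * (χ⁻¹ s * χ t) := by
          refine Finset.sum_congr rfl fun χ _ => ?_
          rw [← Complex.conj_mul', map_sum, Finset.sum_mul_sum]
          refine Finset.sum_congr rfl fun s _ => Finset.sum_congr rfl fun t _ => ?_
          rw [map_mul, starRingEnd_apply, starRingEnd_apply, MulChar.star_apply']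
          ring
      _ = ∑ s, ∑ t, (star (f s) * f t) * ∑ χ : DirichletCharacter ℂ p, χ⁻¹ s * χ t := by
          rw [Finset.sum_comm]
          refine Finset.sum_congr rfl fun s _ => ?_
          rw [Finset.sum_comm]
          simp only [Finset.mul_sum]
      _ = _ := by
          refine Finset.sum_congr rfl fun s _ => ?_
          simp only [sum_inv_char_mul_char]
          by_cases hs : s = 0
          · simp [hs]
          · simp only [ne_eq, hs, not_false_eq_true, true_and, mul_ite, mul_zero,
              Finset.sum_ite_eq, Finset.mem_univ, if_true]
            rw [← starRingEnd_apply, Complex.conj_mul']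
            push_cast
            ring
  -- Characters do not see f 0; this is the only loss in Parseval.
  rw [Complex.ofReal_inj.1 key, Finset.mul_sum]
  refine Finset.sum_le_sum fun s _ => ?_
  split_ifs
  · exact le_rfl
  · exact mul_nonneg (by linarith) (by positivity)

/-- The fourth moment of weighted character sums, reduced to a weighted count of integers in
residue classes. -/
theorem sum_norm_pow_four_le (P D : ℕ) (c : ℕ → ℂ) (v : ℕ → ℝ) (hv0 : ∀ m, 0 ≤ v m)
    (hv : ∀ n ∈ Finset.Icc 1 P, ∀ m ∈ Finset.Icc 1 P, ‖c n‖ * ‖c m‖ ≤ v (n * m))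
    (hD : ∀ m ∈ Finset.Icc 1 (P ^ 2), m.divisors.card ≤ D) :
    ∑ χ : DirichletCharacter ℂ p, ‖∑ n ∈ Finset.Icc 1 P, χ (n : ZMod p) * c n‖ ^ 4 ≤
      (p : ℝ) * D ^ 2 *
        ∑ t : ZMod p, (∑ m ∈ residueClass p (P ^ 2) t, v m) ^ 2 := by
  have hp : p.Prime := Fact.out
  have hp1 : (1 : ℝ) ≤ p := by exact_mod_cast hp.one_le
  set I := Finset.Icc 1 P
  -- The square of the sum is the transform of this multiplicative convolution, so the fourth moment
  -- is a mean square.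
  set f : ZMod p → ℂ := fun t =>
    ∑ x ∈ I ×ˢ I with ((x.1 * x.2 : ℕ) : ZMod p) = t, c x.1 * c x.2 with hf
  have h1 : ∀ χ : DirichletCharacter ℂ p,
      ‖∑ n ∈ I, χ (n : ZMod p) * c n‖ ^ 4 = ‖∑ t, χ t * f t‖ ^ 2 := by
    intro χ
    have : (∑ n ∈ I, χ (n : ZMod p) * c n) ^ 2 = ∑ t, χ t * f t := by
      rw [pow_two, Finset.sum_mul_sum, ← Finset.sum_product',
        ← Finset.sum_fiberwise (I ×ˢ I) (fun x => ((x.1 * x.2 : ℕ) : ZMod p))]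
      refine Finset.sum_congr rfl fun t _ => ?_
      rw [hf, Finset.mul_sum]
      refine Finset.sum_congr rfl fun x hx => ?_
      rw [← (Finset.mem_filter.1 hx).2, Nat.cast_mul, map_mul]
      ring
    rw [← this, norm_pow]
    ring
  have h2 : ∀ t, ‖f t‖ ≤ D * ∑ m ∈ residueClass p (P ^ 2) t, v m := by
    intro t
    calc ‖f t‖ ≤ ∑ x ∈ I ×ˢ I with ((x.1 * x.2 : ℕ) : ZMod p) = t, v (x.1 * x.2) := by
          refine norm_sum_le_of_le _ fun x hx => ?_
          rw [norm_mul]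
          have := Finset.mem_product.1 (Finset.mem_filter.1 hx).1
          exact hv _ this.1 _ this.2
      _ = ∑ m ∈ residueClass p (P ^ 2) t,
            ∑ x ∈ (I ×ˢ I).filter (fun x => ((x.1 * x.2 : ℕ) : ZMod p) = t) with x.1 * x.2 = m,
              v (x.1 * x.2) := by
          refine (Finset.sum_fiberwise_of_maps_to (fun x hx => ?_) _).symm
          obtain ⟨hx1, hx2⟩ := Finset.mem_filter.1 hx
          obtain ⟨ha, hb⟩ := Finset.mem_product.1 hx1
          rw [Finset.mem_Icc] at ha hb
          refine Finset.mem_filter.2 ⟨Finset.mem_Icc.2 ⟨Nat.mul_pos ha.1 hb.1, ?_⟩, hx2⟩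
          rw [pow_two]
          exact Nat.mul_le_mul ha.2 hb.2
      _ ≤ ∑ m ∈ residueClass p (P ^ 2) t, D * v m := by
          refine Finset.sum_le_sum fun m hm => ?_
          have hm1 := (Finset.mem_filter.1 hm).1
          rw [Finset.sum_congr rfl (g := fun _ => v m)
            (fun x hx => by rw [(Finset.mem_filter.1 hx).2]), Finset.sum_const, nsmul_eq_mul]
          refine mul_le_mul_of_nonneg_right ?_ (hv0 m)
          norm_cast
          refine le_trans ?_ (hD m hm1)
          -- A factorisation of the nonzero m is determined by its first factor, a divisor of m.
          refine Finset.card_le_card_of_injOn Prod.fst (fun x hx => ?_) (fun x hx y hy hxy => ?_)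
          · have := (Finset.mem_filter.1 hx).2
            rw [Finset.mem_Icc] at hm1
            exact Nat.mem_divisors.2 ⟨⟨x.2, this.symm⟩, by omega⟩
          · have hx' := (Finset.mem_filter.1 hx).2
            have hy' := (Finset.mem_filter.1 hy).2
            rw [Finset.mem_Icc] at hm1
            have hpos : 0 < x.1 := by
              refine Nat.pos_of_ne_zero fun h => ?_
              rw [h] at hx'
              omega
            exact Prod.ext hxy (Nat.eq_of_mul_eq_mul_left hpos (by rw [hx', hxy, hy']))
      _ = _ := by rw [Finset.mul_sum]
  calc ∑ χ : DirichletCharacter ℂ p, ‖∑ n ∈ I, χ (n : ZMod p) * c n‖ ^ 4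
      = ∑ χ : DirichletCharacter ℂ p, ‖∑ t, χ t * f t‖ ^ 2 := Finset.sum_congr rfl fun χ _ => h1 χ
    _ ≤ ((p : ℝ) - 1) * ∑ t, ‖f t‖ ^ 2 := sum_norm_sq_charTransform_le f
    _ ≤ p * ∑ t : ZMod p,
          (D * ∑ m ∈ residueClass p (P ^ 2) t, v m) ^ 2 := by
        gcongr with t
        · linarith
        · exact h2 t
    _ = _ := by
        simp only [mul_pow, ← Finset.mul_sum]
        ring

/-- The initial segment `χ(1) + ⋯ + χ(M)`. -/
def charSum (χ : DirichletCharacter ℂ p) (M : ℕ) : ℂ := ∑ n ∈ Finset.Icc 1 M, χ (n : ZMod p)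

theorem injOn_natCast_Icc : Set.InjOn (fun n : ℕ => (n : ZMod p)) (Finset.Icc 1 p) := by
  intro a ha b hb hab
  simp only [Finset.coe_Icc, Set.mem_Icc] at ha hb
  have h := (ZMod.natCast_eq_natCast_iff a b p).1 hab
  rcases lt_trichotomy a b with h' | h' | h'
  · have := Nat.le_of_dvd (by omega) ((Nat.modEq_iff_dvd' h'.le).1 h)
    omega
  · exact h'
  · have := Nat.le_of_dvd (by omega) ((Nat.modEq_iff_dvd' h'.le).1 h.symm)
    omega

/-- Parseval for the indicator of 1, …, M, which are distinct residues since M ≤ p. The principal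
character is included. -/
theorem sum_norm_sq_charSum_le {M : ℕ} (hM : M ≤ p) :
    ∑ χ : DirichletCharacter ℂ p, ‖charSum χ M‖ ^ 2 ≤ p * M := by
  classical
  have hp : p.Prime := Fact.out
  have hp1 : (1 : ℝ) ≤ p := by exact_mod_cast hp.one_le
  set J : Finset (ZMod p) := (Finset.Icc 1 M).image (fun n : ℕ => (n : ZMod p)) with hJ
  have hinj : Set.InjOn (fun n : ℕ => (n : ZMod p)) (Finset.Icc 1 M) :=
    injOn_natCast_Icc.mono (by exact_mod_cast Finset.Icc_subset_Icc le_rfl hM)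
  have h1 : ∀ χ : DirichletCharacter ℂ p, charSum χ M = ∑ t, χ t * (if t ∈ J then 1 else 0) := by
    intro χ
    simp only [mul_ite, mul_one, mul_zero, Finset.sum_ite_mem, Finset.univ_inter]
    rw [hJ, Finset.sum_image hinj, charSum]
  have hc : J.card = M := by rw [hJ, Finset.card_image_of_injOn hinj]; simp
  calc ∑ χ : DirichletCharacter ℂ p, ‖charSum χ M‖ ^ 2
      ≤ ((p : ℝ) - 1) * ∑ t, ‖(if t ∈ J then 1 else 0 : ℂ)‖ ^ 2 := by
        simp only [h1]
        exact sum_norm_sq_charTransform_le _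
    _ = ((p : ℝ) - 1) * M := by
        congr 1
        rw [← hc, Finset.card_eq_sum_ones, Nat.cast_sum]
        simp [apply_ite, Finset.sum_ite_mem]
    _ ≤ p * M := by
        gcongr
        linarith

/-- The fourth moment over short initial segments. -/
theorem sum_norm_pow_four_charSum_le_of_sq_le {M : ℕ} (hM : M ^ 2 ≤ p) :
    ∑ χ : DirichletCharacter ℂ p, ‖charSum χ M‖ ^ 4 ≤ p * maxDivisors p ^ 2 * M ^ 2 := by
  classical
  have hp : p.Prime := Fact.out
  have h := sum_norm_pow_four_le (p := p) M (maxDivisors p) (fun _ => 1) (fun _ => 1)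
    (fun _ => zero_le_one) (by simp) (fun m hm => ?_)
  · simp only [mul_one] at h
    refine h.trans ?_
    gcongr
    calc ∑ t : ZMod p, (∑ m ∈ residueClass p (M ^ 2) t, (1 : ℝ)) ^ 2
        ≤ ∑ t : ZMod p, ∑ m ∈ residueClass p (M ^ 2) t, (1 : ℝ) := by
          refine Finset.sum_le_sum fun t _ => ?_
          simp only [Finset.sum_const, nsmul_eq_mul, mul_one]
          set s := residueClass p (M ^ 2) t
          -- Two integers in [1, M²] with M² ≤ p are incongruent unless equal, so squaring the
          -- counts changes nothing.
          have hs : s.card ≤ 1 := by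
            refine Finset.card_le_one.2 fun a ha b hb => ?_
            obtain ⟨ha1, ha2⟩ := Finset.mem_filter.1 ha
            obtain ⟨hb1, hb2⟩ := Finset.mem_filter.1 hb
            rw [Finset.mem_Icc] at ha1 hb1
            refine injOn_natCast_Icc (p := p) ?_ ?_ (ha2.trans hb2.symm)
            · simp only [Finset.coe_Icc, Set.mem_Icc]; omega
            · simp only [Finset.coe_Icc, Set.mem_Icc]; omega
          have : (s.card : ℝ) ≤ 1 := by exact_mod_cast hs
          nlinarith [Nat.cast_nonneg (α := ℝ) s.card]
      _ = (M : ℝ) ^ 2 := by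
          unfold residueClass
          rw [Finset.sum_fiberwise (Finset.Icc 1 (M ^ 2)) (fun m : ℕ => (m : ZMod p))]
          simp
  · rw [Finset.mem_Icc] at hm
    refine card_divisors_le_maxDivisors (by omega) ?_
    nlinarith [hp.one_le]

end Moments

/-! ### Completion by Gauss sums and Pólya–Vinogradov -/

section Completion

variable {p : ℕ} [Fact p.Prime]

/-- The nonzero residues whose least absolute representative is at most `M`. -/
def signedBox (p M : ℕ) [Fact p.Prime] : Finset (ZMod p) :=
  Finset.univ.filter fun x => x ≠ 0 ∧ |x.valMinAbs| ≤ (M : ℤ)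

theorem mem_signedBox {M : ℕ} {x : ZMod p} :
    x ∈ signedBox p M ↔ x ≠ 0 ∧ |x.valMinAbs| ≤ (M : ℤ) := by simp [signedBox]

theorem valMinAbs_intCast_of_abs_le {z : ℤ} (h : |z| ≤ ((p - 1) / 2 : ℕ)) :
    (z : ZMod p).valMinAbs = z := by
  have hp : p.Prime := Fact.out
  have := hp.one_lt
  rw [ZMod.valMinAbs_spec]
  refine ⟨rfl, ?_⟩
  rw [abs_le] at h
  simp only [Set.mem_Ioc]
  omega

/-- For M ≤ (p - 1)/2 the residues ±1, …, ±M are distinct and are their own least absolute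
representatives. This links symmetric boxes with the one-sided sums in σ and ρ. -/
theorem sum_signedBox {E : Type*} [AddCommMonoid E] {M : ℕ} (hM : M ≤ (p - 1) / 2)
    (f : ZMod p → E) :
    ∑ x ∈ signedBox p M, f x = ∑ n ∈ Finset.Icc 1 M, (f n + f (-(n : ZMod p))) := by
  have hp : p.Prime := Fact.out
  have e1 : ∀ n ∈ Finset.Icc 1 M, ((n : ZMod p)).valMinAbs = n := fun n hn => by
    have := valMinAbs_intCast_of_abs_le (p := p) (z := n) (by
      rw [Finset.mem_Icc] at hn
      rw [Nat.abs_cast]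
      exact_mod_cast hn.2.trans hM)
    simpa using this
  have e2 : ∀ n ∈ Finset.Icc 1 M, (-(n : ZMod p)).valMinAbs = -n := fun n hn => by
    have := valMinAbs_intCast_of_abs_le (p := p) (z := -n) (by
      rw [Finset.mem_Icc] at hn
      rw [abs_neg, Nat.abs_cast]
      exact_mod_cast hn.2.trans hM)
    simpa using this
  have hs : signedBox p M = (Finset.Icc 1 M).image (fun n : ℕ => (n : ZMod p)) ∪
      (Finset.Icc 1 M).image (fun n : ℕ => -(n : ZMod p)) := by
    ext x
    rw [mem_signedBox, Finset.mem_union, Finset.mem_image, Finset.mem_image]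
    constructor
    · rintro ⟨hx0, hx⟩
      have hv : x.valMinAbs ≠ 0 := by simpa using hx0
      rw [abs_le] at hx
      have hc := ZMod.coe_valMinAbs x
      rcases le_total 0 x.valMinAbs with h | h
      · left
        refine ⟨x.valMinAbs.natAbs, Finset.mem_Icc.2 ⟨by omega, by omega⟩, ?_⟩
        conv_rhs => rw [← hc]
        rw [← Int.cast_natCast, Int.natAbs_of_nonneg h]
      · right
        refine ⟨x.valMinAbs.natAbs, Finset.mem_Icc.2 ⟨by omega, by omega⟩, ?_⟩
        conv_rhs => rw [← hc]
        rw [← Int.cast_natCast, Int.ofNat_natAbs_of_nonpos h, Int.cast_neg, neg_neg]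
    · rintro (⟨n, hn, rfl⟩ | ⟨n, hn, rfl⟩)
      · have h := e1 n hn
        rw [Finset.mem_Icc] at hn
        refine ⟨fun h0 => ?_, ?_⟩
        · rw [h0, ZMod.valMinAbs_zero] at h
          omega
        · rw [h, Nat.abs_cast]
          exact_mod_cast hn.2
      · have h := e2 n hn
        rw [Finset.mem_Icc] at hn
        refine ⟨fun h0 => ?_, ?_⟩
        · rw [h0, ZMod.valMinAbs_zero] at h
          omega
        · rw [h, abs_neg, Nat.abs_cast]
          exact_mod_cast hn.2
  rw [hs, Finset.sum_union, Finset.sum_image, Finset.sum_image, Finset.sum_add_distrib]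
  · intro a ha b hb hab
    have := congrArg ZMod.valMinAbs hab
    simp only [e2 a ha, e2 b hb] at this
    omega
  · intro a ha b hb hab
    have := congrArg ZMod.valMinAbs hab
    simp only [e1 a ha, e1 b hb] at this
    omega
  · rw [Finset.disjoint_left]
    intro x hx hx'
    obtain ⟨n, hn, rfl⟩ := Finset.mem_image.1 hx
    obtain ⟨m, hm, h⟩ := Finset.mem_image.1 hx'
    have := congrArg ZMod.valMinAbs h
    rw [e1 n hn, e2 m hm] at this
    rw [Finset.mem_Icc] at hn hm
    omega

theorem card_signedBox {M : ℕ} (hM : M ≤ (p - 1) / 2) :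
    (signedBox p M).card = 2 * M := by
  rw [Finset.card_eq_sum_ones, sum_signedBox hM]
  simp [mul_comm]

theorem sum_eq_sum_Icc_add_neg {E : Type*} [AddCommMonoid E] (hp2 : p ≠ 2) (f : ZMod p → E)
    (h0 : f 0 = 0) :
    ∑ x, f x = ∑ n ∈ Finset.Icc 1 ((p - 1) / 2), (f n + f (-(n : ZMod p))) := by
  have hp : p.Prime := Fact.out
  rw [← sum_signedBox le_rfl]
  refine (Finset.sum_subset (Finset.subset_univ _) fun x _ hx => ?_).symm
  rw [mem_signedBox] at hx
  by_cases hx0 : x = 0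
  · rw [hx0, h0]
  · refine absurd ⟨hx0, ?_⟩ hx
    have h1 := ZMod.natAbs_valMinAbs_le x
    have h2 := hp.eq_two_or_odd
    rw [abs_le]
    constructor <;> omega

/-- The additive exponential sum over an initial segment. -/
def expSum (M : ℕ) (h : ZMod p) : ℂ := ∑ n ∈ Finset.Icc 1 M, ZMod.stdAddChar ((n : ZMod p) * h)

/-- Each n ≤ M < p is a unit, so h ↦ nh turns χ(n) times the Gauss sum of χ⁻¹ into ∑ χ⁻¹(h) e(nh/p);
then sum over n. -/
theorem charSum_mul_gaussSum {M : ℕ} (hM : M < p) (χ : DirichletCharacter ℂ p) :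
    charSum χ M * gaussSum χ⁻¹ ZMod.stdAddChar = ∑ h, χ⁻¹ h * expSum M h := by
  simp only [expSum, Finset.mul_sum]
  rw [Finset.sum_comm, charSum, Finset.sum_mul]
  refine Finset.sum_congr rfl fun n hn => ?_
  rw [Finset.mem_Icc] at hn
  have hn0 : (n : ZMod p) ≠ 0 := by
    rw [Ne, ZMod.natCast_eq_zero_iff]
    exact fun h => by have := Nat.le_of_dvd (by omega) h; omega
  have := gaussSum_mulShift_eq χ⁻¹ ZMod.stdAddChar (Units.mk0 _ hn0)
  rw [inv_inv, Units.val_mk0] at this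
  rw [← this, gaussSum]
  simp [AddChar.mulShift_apply]

theorem norm_gaussSum_stdAddChar {χ : DirichletCharacter ℂ p} (hχ : χ ≠ 1) :
    ‖gaussSum χ ZMod.stdAddChar‖ = √p := by
  have h := gaussSum_mul_gaussSum_eq_card hχ (ZMod.isPrimitive_stdAddChar p)
  rw [← star_gaussSum_eq, ← starRingEnd_apply, Complex.mul_conj', ZMod.card] at h
  have h' : ‖gaussSum χ ZMod.stdAddChar‖ ^ 2 = p := by exact_mod_cast h
  rw [← h', Real.sqrt_sq (norm_nonneg _)]

theorem norm_expSum_le (M : ℕ) (h : ZMod p) : ‖expSum M h‖ ≤ M := by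
  calc ‖expSum M h‖ ≤ ∑ n ∈ Finset.Icc 1 M, (1 : ℝ) :=
        norm_sum_le_of_le _ fun n _ => (AddChar.norm_apply _ _).le
    _ = M := by simp

theorem norm_expSum_neg (M : ℕ) (h : ZMod p) : ‖expSum M (-h)‖ = ‖expSum M h‖ := by
  have : expSum M (-h) = (starRingEnd ℂ) (expSum M h) := by
    simp only [expSum, map_sum, mul_neg, AddChar.map_neg_eq_conj]
  rw [this, RCLike.norm_conj]

/-- A geometric series with ratio z = e(n/p): the numerator is at most 2, and |z - 1| = 2 sin(πn/p)
≥ 4n/p by Jordan's inequality, valid as n ≤ p/2. -/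
theorem norm_expSum_natCast_le (M : ℕ) {n : ℕ} (hn : n ∈ Finset.Icc 1 ((p - 1) / 2)) :
    ‖expSum M (n : ZMod p)‖ ≤ p / (2 * n) := by
  have hp : p.Prime := Fact.out
  have hp0 : (0 : ℝ) < p := by exact_mod_cast hp.pos
  rw [Finset.mem_Icc] at hn
  have hn0 : (0 : ℝ) < n := by exact_mod_cast hn.1
  have hnp : (n : ℝ) ≤ p / 2 := by
    rw [le_div_iff₀ two_pos]
    exact_mod_cast (show n * 2 ≤ p by omega)
  set z : ℂ := ZMod.stdAddChar (n : ZMod p) with hz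
  have hz1 : ‖z‖ = 1 := AddChar.norm_apply _ _
  have hsum : expSum M (n : ZMod p) * (z - 1) = z * (z ^ M - 1) := by
    have : expSum M (n : ZMod p) = z * ∑ k ∈ Finset.range M, z ^ k := by
      rw [expSum, ← Finset.Ico_add_one_right_eq_Icc, Finset.sum_Ico_eq_sum_range,
        Nat.add_sub_cancel, Finset.mul_sum]
      refine Finset.sum_congr rfl fun k _ => ?_
      rw [← nsmul_eq_mul, AddChar.map_nsmul_eq_pow, ← hz, add_comm, pow_succ']
    rw [this, mul_assoc, geom_sum_mul]
  have hz2 : z = Complex.exp (Complex.I * ((2 * Real.pi * n / p : ℝ) : ℂ)) := by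
    rw [hz, ← Int.cast_natCast, ZMod.stdAddChar_coe]
    congr 1
    push_cast
    ring
  have hsin : 4 * n / p ≤ ‖z - 1‖ := by
    rw [hz2, Complex.norm_exp_I_mul_ofReal_sub_one, Real.norm_eq_abs]
    refine le_trans ?_ (le_abs_self _)
    have := Real.mul_le_sin (x := 2 * Real.pi * n / p / 2) (by positivity) (by
      rw [div_div, div_le_div_iff₀ (by positivity) two_pos]
      nlinarith [Real.pi_pos])
    have e : 2 / Real.pi * (2 * Real.pi * n / p / 2) = 2 * n / p := by
      field_simp
    rw [e] at this
    calc (4 * n / p : ℝ) = 2 * (2 * n / p) := by ring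
      _ ≤ _ := by linarith
  have hnum : ‖z * (z ^ M - 1)‖ ≤ 2 := by
    rw [norm_mul, hz1, one_mul]
    calc ‖z ^ M - 1‖ ≤ ‖z ^ M‖ + ‖(1 : ℂ)‖ := norm_sub_le _ _
      _ = 2 := by rw [norm_pow, hz1]; norm_num
  rw [← hsum, norm_mul] at hnum
  have h4 : ‖expSum M (n : ZMod p)‖ * (4 * n / p) ≤ 2 :=
    (mul_le_mul_of_nonneg_left hsin (norm_nonneg _)).trans hnum
  rw [le_div_iff₀ (by positivity)]
  have : ‖expSum M (n : ZMod p)‖ * (4 * n / p) * p = ‖expSum M (n : ZMod p)‖ * (2 * n) * 2 := by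
    field_simp
    ring
  nlinarith

theorem sum_Icc_inv_le {N : ℕ} (hN : N ≤ p) :
    ∑ n ∈ Finset.Icc 1 N, ((n : ℝ))⁻¹ ≤ 1 + Real.log p := by
  have hp : p.Prime := Fact.out
  have hp0 : (0 : ℝ) < p := by exact_mod_cast hp.pos
  have h := harmonic_le_one_add_log p
  rw [harmonic_eq_sum_Icc] at h
  push_cast at h
  refine le_trans (Finset.sum_le_sum_of_subset_of_nonneg (Finset.Icc_subset_Icc le_rfl hN) ?_) h
  intros
  positivity

/-- The completed sum, folded at zero. -/
theorem sqrt_mul_norm_charSum_le (hp2 : p ≠ 2) {M : ℕ} (hM : M < p) {χ : DirichletCharacter ℂ p}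
    (hχ : χ ≠ 1) :
    √p * ‖charSum χ M‖ ≤
      ‖∑ n ∈ Finset.Icc 1 ((p - 1) / 2), χ⁻¹ (n : ZMod p) * expSum M (n : ZMod p)‖ +
      ‖∑ n ∈ Finset.Icc 1 ((p - 1) / 2), χ⁻¹ (n : ZMod p) * expSum M (-(n : ZMod p))‖ := by
  rw [← norm_gaussSum_stdAddChar (inv_ne_one.2 hχ), mul_comm, ← norm_mul,
    charSum_mul_gaussSum hM, sum_eq_sum_Icc_add_neg hp2 _ (by rw [MulChar.map_zero, zero_mul]),
    Finset.sum_add_distrib]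
  refine (norm_add_le _ _).trans (add_le_add_right ?_ _)
  -- Negative frequencies only bring in χ⁻¹(-1), of norm at most 1. Both halves then run over
  -- positive integers, to which the divisor argument applies.
  have : ∑ n ∈ Finset.Icc 1 ((p - 1) / 2), χ⁻¹ (-(n : ZMod p)) * expSum M (-(n : ZMod p)) =
      χ⁻¹ (-1) * ∑ n ∈ Finset.Icc 1 ((p - 1) / 2), χ⁻¹ (n : ZMod p) * expSum M (-(n : ZMod p)) := by
    rw [Finset.mul_sum]
    refine Finset.sum_congr rfl fun n _ => ?_
    rw [← mul_assoc, ← map_mul, neg_one_mul]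
  rw [this, norm_mul]
  exact mul_le_of_le_one_left (norm_nonneg _) (DirichletCharacter.norm_le_one _ _)

/-- The Pólya–Vinogradov inequality. -/
theorem norm_charSum_le (hp2 : p ≠ 2) {M : ℕ} (hM : M < p) {χ : DirichletCharacter ℂ p}
    (hχ : χ ≠ 1) : ‖charSum χ M‖ ≤ √p * (1 + Real.log p) := by
  have hp : p.Prime := Fact.out
  have hp0 : (0 : ℝ) < p := by exact_mod_cast hp.pos
  have h := sqrt_mul_norm_charSum_le hp2 hM hχ
  have hb : ∀ c : ℕ → ℂ, (∀ n ∈ Finset.Icc 1 ((p - 1) / 2), ‖c n‖ ≤ p / (2 * n)) →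
      ‖∑ n ∈ Finset.Icc 1 ((p - 1) / 2), χ⁻¹ (n : ZMod p) * c n‖ ≤
        p / 2 * (1 + Real.log p) := by
    intro c hc
    calc _ ≤ ∑ n ∈ Finset.Icc 1 ((p - 1) / 2), p / 2 * ((n : ℝ))⁻¹ := by
          refine norm_sum_le_of_le _ fun n hn => ?_
          rw [norm_mul]
          refine (mul_le_of_le_one_left (norm_nonneg _)
            (DirichletCharacter.norm_le_one _ _)).trans ((hc n hn).trans_eq ?_)
          rw [← div_div, div_eq_mul_inv (p / 2 : ℝ)]
      _ ≤ _ := by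
          rw [← Finset.mul_sum]
          gcongr
          exact sum_Icc_inv_le (by omega)
  have h1 := hb (fun n => expSum M (n : ZMod p)) fun n hn => norm_expSum_natCast_le M hn
  have h2 := hb (fun n => expSum M (-(n : ZMod p))) fun n hn => by
    rw [norm_expSum_neg]
    exact norm_expSum_natCast_le M hn
  have hs : (0 : ℝ) < √p := Real.sqrt_pos.2 hp0
  refine le_of_mul_le_mul_left ?_ hs
  rw [← mul_assoc, Real.mul_self_sqrt hp0.le]
  linarith

end Completion

/-! ### The fourth moment of incomplete character sums -/

section FourthMoment

variable {p : ℕ} [Fact p.Prime]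

theorem sum_val_eq_sum_range (u : ℕ → ℝ) : ∑ t : ZMod p, u t.val = ∑ k ∈ Finset.range p, u k := by
  refine Finset.sum_nbij ZMod.val (fun t _ => Finset.mem_range.2 (ZMod.val_lt t))
    (fun a _ b _ h => ZMod.val_injective p h) (fun k hk => ?_) (fun _ _ => rfl)
  exact ⟨k, Finset.mem_coe.2 (Finset.mem_univ _), ZMod.val_cast_of_lt (by simpa using hk)⟩

theorem sum_range_succ_inv_le :
    ∑ k ∈ Finset.range (p - 1), ((k + 1 : ℕ) : ℝ)⁻¹ ≤ 1 + Real.log p := by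
  refine le_trans (le_of_eq ?_) (sum_Icc_inv_le (p := p) (N := p - 1) (by omega))
  rw [← Finset.Ico_add_one_right_eq_Icc, Finset.sum_Ico_eq_sum_range, Nat.add_sub_cancel]
  exact Finset.sum_congr rfl fun k _ => by rw [add_comm]

/-- Write m = kp + t.val with k < p. The single term k = 0 keeps the minimum (and is absent for t =
0, as m ≥ 1); a term with k ≥ 1 is at most p/k, which sums harmonically. -/
theorem sum_residueClass_le (M : ℝ) {N : ℕ} (hN : N < p ^ 2) (t : ZMod p) :
    ∑ m ∈ residueClass p N t, min (M ^ 2) ((p : ℝ) ^ 2 / m) ≤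
      (if t.val = 0 then 0 else min (M ^ 2) ((p : ℝ) ^ 2 / t.val)) + p * (1 + Real.log p) := by
  have hp : p.Prime := Fact.out
  have hp0 : (0 : ℝ) < p := by exact_mod_cast hp.pos
  set u : ℝ := if t.val = 0 then 0 else min (M ^ 2) ((p : ℝ) ^ 2 / t.val) with hu
  have hu0 : 0 ≤ u := by
    rw [hu]
    split_ifs
    · exact le_rfl
    · exact le_min (by positivity) (by positivity)
  set b : ℕ → ℝ := fun k => if k = 0 then u else p * (k : ℝ)⁻¹ with hb
  have hmod : ∀ m ∈ residueClass p N t, m % p = t.val := fun m hm => by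
    rw [← (Finset.mem_filter.1 hm).2, ZMod.val_natCast]
  have hinj : Set.InjOn (fun m => m / p) (residueClass p N t : Set ℕ) := by
    intro x hx y hy hxy
    have h1 := Nat.div_add_mod x p
    have h2 := Nat.div_add_mod y p
    simp only at hxy
    rw [hmod x hx, hxy] at h1
    rw [hmod y hy] at h2
    exact h1.symm.trans h2
  calc ∑ m ∈ residueClass p N t, min (M ^ 2) ((p : ℝ) ^ 2 / m)
      ≤ ∑ m ∈ residueClass p N t, b (m / p) := by
        refine Finset.sum_le_sum fun m hm => ?_
        have hm1 := Finset.mem_Icc.1 (Finset.mem_filter.1 hm).1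
        have hdm := Nat.div_add_mod m p
        simp only [hb]
        split_ifs with h
        · rw [h, mul_zero, zero_add, hmod m hm] at hdm
          rw [hu, if_neg (by omega), hdm]
        · refine (min_le_right _ _).trans ?_
          have hk : (0 : ℝ) < (m / p : ℕ) := by exact_mod_cast Nat.pos_of_ne_zero h
          have hle : ((m / p : ℕ) : ℝ) * p ≤ m := by exact_mod_cast Nat.div_mul_le_self m p
          have hm0 : (0 : ℝ) < m := by exact_mod_cast hm1.1
          rw [← div_eq_mul_inv, div_le_div_iff₀ hm0 hk]
          nlinarith
    _ = ∑ k ∈ (residueClass p N t).image (fun m => m / p), b k := (Finset.sum_image hinj).symm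
    _ ≤ ∑ k ∈ Finset.range p, b k := by
        refine Finset.sum_le_sum_of_subset_of_nonneg (fun k hk => ?_) (fun k _ _ => ?_)
        · obtain ⟨m, hm, rfl⟩ := Finset.mem_image.1 hk
          have hm1 := Finset.mem_Icc.1 (Finset.mem_filter.1 hm).1
          rw [Finset.mem_range, Nat.div_lt_iff_lt_mul hp.pos, ← pow_two]
          omega
        · simp only [hb]
          split_ifs
          · exact hu0
          · positivity
    _ = u + p * ∑ k ∈ Finset.range (p - 1), ((k + 1 : ℕ) : ℝ)⁻¹ := by
        conv_lhs => rw [← Nat.sub_add_cancel hp.one_le, Finset.sum_range_succ']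
        simp only [hb, if_true, Nat.add_one_ne_zero, if_false, Finset.mul_sum]
        rw [add_comm]
    _ ≤ _ := by
        gcongr
        exact sum_range_succ_inv_le

/-- Bound one factor of the square by M² and the other by p²/k. -/
theorem sum_sq_min_le (M : ℝ) :
    ∑ t : ZMod p, (if t.val = 0 then 0 else min (M ^ 2) ((p : ℝ) ^ 2 / t.val)) ^ 2 ≤
      M ^ 2 * p ^ 2 * (1 + Real.log p) := by
  have hp : p.Prime := Fact.out
  rw [sum_val_eq_sum_range (fun k => (if k = 0 then 0 else min (M ^ 2) ((p : ℝ) ^ 2 / k)) ^ 2)]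
  rw [← Nat.sub_add_cancel hp.one_le, Finset.sum_range_succ']
  simp only [if_true, Nat.add_one_ne_zero, if_false, Nat.sub_add_cancel hp.one_le]
  rw [zero_pow two_ne_zero, add_zero]
  calc _ ≤ ∑ k ∈ Finset.range (p - 1), M ^ 2 * p ^ 2 * ((k + 1 : ℕ) : ℝ)⁻¹ := by
        refine Finset.sum_le_sum fun k _ => ?_
        have h0 : 0 ≤ min (M ^ 2) ((p : ℝ) ^ 2 / (k + 1 : ℕ)) :=
          le_min (by positivity) (by positivity)
        rw [pow_two (min _ _), mul_assoc, ← div_eq_mul_inv]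
        exact mul_le_mul (min_le_left _ _) (min_le_right _ _) h0 (by positivity)
    _ ≤ _ := by
        rw [← Finset.mul_sum]
        gcongr
        exact sum_range_succ_inv_le

/-- The weight min(M², p²/m) majorises products of coefficients. In the residue-class sums the terms
m < p contribute M²p²L with L = 1 + log p, and the tails p · (pL)², which p ≤ M² makes no larger
than M²p²L². -/
theorem sum_norm_pow_four_completed_le {M : ℕ} (hM : p ≤ M ^ 2) (c : ℕ → ℂ)
    (hc1 : ∀ n, ‖c n‖ ≤ M) (hc2 : ∀ n ∈ Finset.Icc 1 ((p - 1) / 2), ‖c n‖ ≤ p / (2 * n)) :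
    ∑ χ : DirichletCharacter ℂ p,
      ‖∑ n ∈ Finset.Icc 1 ((p - 1) / 2), χ (n : ZMod p) * c n‖ ^ 4 ≤
      4 * (p : ℝ) ^ 3 * M ^ 2 * lossFactor p := by
  have hp : p.Prime := Fact.out
  have hp0 : (0 : ℝ) < p := by exact_mod_cast hp.pos
  set P := (p - 1) / 2 with hP
  have hPp : P ^ 2 < p ^ 2 := Nat.pow_lt_pow_left (by have := hp.two_le; omega) two_ne_zero
  set L := 1 + Real.log p with hL
  have hL1 : 1 ≤ L := by
    have := Real.log_natCast_nonneg p
    linarith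
  have h := sum_norm_pow_four_le (p := p) P (maxDivisors p) c
    (fun m => min ((M : ℝ) ^ 2) ((p : ℝ) ^ 2 / m)) (fun m => le_min (by positivity) (by positivity))
    (fun n hn m hm => ?_) (fun m hm => ?_)
  · refine h.trans ?_
    have hMp : (p : ℝ) ≤ (M : ℝ) ^ 2 := by exact_mod_cast hM
    have hsum : ∑ t : ZMod p,
        (∑ m ∈ residueClass p (P ^ 2) t, min ((M : ℝ) ^ 2) ((p : ℝ) ^ 2 / m)) ^ 2 ≤
        4 * M ^ 2 * p ^ 2 * L ^ 2 := by
      calc _ ≤ ∑ t : ZMod p, (2 * (if t.val = 0 then 0 else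
              min ((M : ℝ) ^ 2) ((p : ℝ) ^ 2 / t.val)) ^ 2 + 2 * (p * L) ^ 2) := by
            refine Finset.sum_le_sum fun t _ => ?_
            have h1 := sum_residueClass_le (M : ℝ) hPp t
            have h0 : 0 ≤ ∑ m ∈ residueClass p (P ^ 2) t, min ((M : ℝ) ^ 2) ((p : ℝ) ^ 2 / m) :=
              Finset.sum_nonneg fun m _ => le_min (by positivity) (by positivity)
            refine (pow_le_pow_left₀ h0 h1 2).trans ?_
            rw [← mul_add]
            exact add_sq_le
        _ ≤ 2 * (M ^ 2 * p ^ 2 * L) + 2 * p * (p * L) ^ 2 := by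
            rw [Finset.sum_add_distrib, ← Finset.mul_sum]
            have := sum_sq_min_le (p := p) M
            simp only [Finset.sum_const, Finset.card_univ, ZMod.card, nsmul_eq_mul]
            rw [← mul_assoc (p : ℝ) 2, mul_comm (p : ℝ) 2]
            gcongr
        _ ≤ 2 * (M ^ 2 * p ^ 2 * L ^ 2) + 2 * M ^ 2 * (p * L) ^ 2 := by
            gcongr
            nlinarith
        _ = _ := by ring
    calc _ ≤ (p : ℝ) * maxDivisors p ^ 2 * (4 * M ^ 2 * p ^ 2 * L ^ 2) := by gcongr
      _ = _ := by
        rw [lossFactor]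
        ring
  · have hn0 := (Finset.mem_Icc.1 hn).1
    have hm0 := (Finset.mem_Icc.1 hm).1
    have hn0' : (0 : ℝ) < n := by exact_mod_cast hn0
    have hm0' : (0 : ℝ) < m := by exact_mod_cast hm0
    refine le_min ?_ ?_
    · rw [pow_two]
      exact mul_le_mul (hc1 n) (hc1 m) (norm_nonneg _) (by positivity)
    · calc ‖c n‖ * ‖c m‖ ≤ p / (2 * n) * (p / (2 * m)) :=
            mul_le_mul (hc2 n hn) (hc2 m hm) (norm_nonneg _) (by positivity)
        _ = (p : ℝ) ^ 2 / (n * m) / 4 := by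
            field_simp
            norm_num
        _ ≤ (p : ℝ) ^ 2 / ((n * m : ℕ) : ℝ) := by
            push_cast
            exact div_le_self (by positivity) (by norm_num)
  · rw [Finset.mem_Icc] at hm
    exact card_divisors_le_maxDivisors (by omega) (by omega)

open scoped Classical in
/-- The fourth moment of incomplete sums over nonprincipal characters. -/
theorem sum_norm_pow_four_charSum_le (hp2 : p ≠ 2) {M : ℕ} (hM : M < p) :
    ∑ χ ∈ (Finset.univ : Finset (DirichletCharacter ℂ p)).erase 1, ‖charSum χ M‖ ^ 4 ≤
      64 * (p * M ^ 2 * lossFactor p) := by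
  have hp : p.Prime := Fact.out
  have hp0 : (0 : ℝ) < p := by exact_mod_cast hp.pos
  have hL1 : 1 ≤ 1 + Real.log p := by
    have := Real.log_natCast_nonneg p
    linarith
  rcases le_total (M ^ 2) p with h | h
  · calc _ ≤ ∑ χ : DirichletCharacter ℂ p, ‖charSum χ M‖ ^ 4 :=
          Finset.sum_le_sum_of_subset_of_nonneg (Finset.erase_subset _ _)
            (fun _ _ _ => by positivity)
      _ ≤ p * maxDivisors p ^ 2 * M ^ 2 := sum_norm_pow_four_charSum_le_of_sq_le h
      _ = 1 * (p * M ^ 2 * (maxDivisors p ^ 2 * 1 ^ 2)) := by ring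
      _ ≤ _ := by
          rw [lossFactor]
          gcongr
          norm_num
  · have h1 := sum_norm_pow_four_completed_le h (fun n => expSum M (n : ZMod p))
      (fun n => norm_expSum_le M _) (fun n hn => norm_expSum_natCast_le M hn)
    have h2 := sum_norm_pow_four_completed_le h (fun n => expSum M (-(n : ZMod p)))
      (fun n => norm_expSum_le M _) (fun n hn => by
        rw [norm_expSum_neg]
        exact norm_expSum_natCast_le M hn)
    -- Completion of the χ-sum produces χ⁻¹, so the moments are reindexed by inversion.
    rw [← Equiv.sum_comp (Equiv.inv (DirichletCharacter ℂ p))] at h1 h2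
    simp only [Equiv.inv_apply] at h1 h2
    -- The fourth power of the Gauss sum is p². The constant is 64 = 8 · (4 + 4), with (x + y)⁴ ≤
    -- 8(x⁴ + y⁴).
    refine le_of_mul_le_mul_left ?_ (by positivity : (0 : ℝ) < (p : ℝ) ^ 2)
    rw [Finset.mul_sum]
    calc _ ≤ ∑ χ ∈ (Finset.univ : Finset (DirichletCharacter ℂ p)).erase 1,
          8 * (‖∑ n ∈ Finset.Icc 1 ((p - 1) / 2), χ⁻¹ (n : ZMod p) * expSum M (n : ZMod p)‖ ^ 4 +
          ‖∑ n ∈ Finset.Icc 1 ((p - 1) / 2),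
            χ⁻¹ (n : ZMod p) * expSum M (-(n : ZMod p))‖ ^ 4) := by
          refine Finset.sum_le_sum fun χ hχ => ?_
          have h3 := sqrt_mul_norm_charSum_le hp2 hM (Finset.ne_of_mem_erase hχ)
          have h4 : (p : ℝ) ^ 2 * ‖charSum χ M‖ ^ 4 = (√p * ‖charSum χ M‖) ^ 4 := by
            rw [mul_pow, show (√(p : ℝ)) ^ 4 = ((√(p : ℝ)) ^ 2) ^ 2 by ring, Real.sq_sqrt hp0.le]
          rw [h4]
          refine (pow_le_pow_left₀ (by positivity) h3 4).trans ?_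
          have := add_pow_le (norm_nonneg (∑ n ∈ Finset.Icc 1 ((p - 1) / 2),
            χ⁻¹ (n : ZMod p) * expSum M (n : ZMod p))) (norm_nonneg
            (∑ n ∈ Finset.Icc 1 ((p - 1) / 2), χ⁻¹ (n : ZMod p) * expSum M (-(n : ZMod p)))) 4
          norm_num at this
          exact this
      _ ≤ ∑ χ : DirichletCharacter ℂ p,
          8 * (‖∑ n ∈ Finset.Icc 1 ((p - 1) / 2), χ⁻¹ (n : ZMod p) * expSum M (n : ZMod p)‖ ^ 4 +
          ‖∑ n ∈ Finset.Icc 1 ((p - 1) / 2),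
            χ⁻¹ (n : ZMod p) * expSum M (-(n : ZMod p))‖ ^ 4) :=
          Finset.sum_le_sum_of_subset_of_nonneg (Finset.erase_subset _ _)
            (fun _ _ _ => by positivity)
      _ ≤ 8 * (4 * (p : ℝ) ^ 3 * M ^ 2 * lossFactor p + 4 * (p : ℝ) ^ 3 * M ^ 2 * lossFactor p) := by
          rw [← Finset.mul_sum, Finset.sum_add_distrib]
          gcongr
      _ = _ := by ring

/-- The fourth moment of incomplete sums over all characters. -/
theorem sum_univ_norm_pow_four_charSum_le (hp2 : p ≠ 2) {M : ℕ} (hM : M < p) :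
    ∑ χ : DirichletCharacter ℂ p, ‖charSum χ M‖ ^ 4 ≤
      M ^ 4 + 64 * (p * M ^ 2 * lossFactor p) := by
  classical
  rw [← Finset.add_sum_erase _ _ (Finset.mem_univ 1)]
  refine add_le_add ?_ (sum_norm_pow_four_charSum_le hp2 hM)
  refine pow_le_pow_left₀ (norm_nonneg _) ?_ 4
  calc ‖charSum (1 : DirichletCharacter ℂ p) M‖ ≤ ∑ n ∈ Finset.Icc 1 M, (1 : ℝ) :=
        norm_sum_le_of_le _ fun n _ => DirichletCharacter.norm_le_one _ _
    _ = M := by simp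

end FourthMoment

/-! ### Character expansion of the box count of an invariant set -/

/-- The Mellin transform of a finite set of pairs. -/
def pairTransform {p : ℕ} (S : Finset (ZMod p × ZMod p)) (χ₁ χ₂ : DirichletCharacter ℂ p) : ℂ :=
  ∑ x ∈ S, χ₁ x.1 * χ₂ x.2

theorem norm_pairTransform_le {p : ℕ} (S : Finset (ZMod p × ZMod p))
    (χ₁ χ₂ : DirichletCharacter ℂ p) :
    ‖pairTransform S χ₁ χ₂‖ ≤ S.card := by
  calc ‖pairTransform S χ₁ χ₂‖ ≤ ∑ x ∈ S, (1 : ℝ) := norm_sum_le_of_le _ fun x _ => by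
        rw [norm_mul]
        exact mul_le_one₀ (DirichletCharacter.norm_le_one _ _) (norm_nonneg _)
          (DirichletCharacter.norm_le_one _ _)
    _ = S.card := by simp

section PairExpansion

variable {p : ℕ} [Fact p.Prime]

/-- The sum of a character over the nonzero residues of height at most `M`. -/
def boxSum (χ : DirichletCharacter ℂ p) (M : ℕ) : ℂ := ∑ x ∈ signedBox p M, χ x

/-- Inversion is conjugation on values, and symmetry of the box gives the factor 1 + χ(-1). -/
theorem norm_boxSum_inv_le {M : ℕ} (hM : M ≤ (p - 1) / 2) (χ : DirichletCharacter ℂ p) :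
    ‖boxSum χ⁻¹ M‖ ≤ 2 * ‖charSum χ M‖ := by
  have h1 : boxSum χ⁻¹ M = (starRingEnd ℂ) (boxSum χ M) := by
    simp only [boxSum, map_sum, starRingEnd_apply, MulChar.star_apply']
  have h2 : boxSum χ M = (1 + χ (-1)) * charSum χ M := by
    rw [boxSum, sum_signedBox hM, charSum, Finset.mul_sum]
    refine Finset.sum_congr rfl fun n _ => ?_
    rw [add_mul, one_mul, ← map_mul, neg_one_mul]
  rw [h1, RCLike.norm_conj, h2, norm_mul]
  gcongr
  calc ‖1 + χ (-1)‖ ≤ ‖(1 : ℂ)‖ + ‖χ (-1)‖ := norm_add_le _ _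
    _ ≤ 1 + 1 := add_le_add (by simp) (DirichletCharacter.norm_le_one _ _)
    _ = 2 := by norm_num

theorem boxSum_one {M : ℕ} (hM : M ≤ (p - 1) / 2) :
    boxSum (1 : DirichletCharacter ℂ p) M = 2 * M := by
  rw [boxSum, Finset.sum_congr rfl (g := fun _ => (1 : ℂ)), Finset.sum_const, card_signedBox hM]
  · simp
  · intro x hx
    exact MulChar.one_apply (isUnit_iff_ne_zero.2 (mem_signedBox.1 hx).1)

/-- Moving S by u permutes it and multiplies the transform by (χ₁^k χ₂^l)(u), so a nonzero transform
forces this value to be 1 for every unit u. -/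
theorem pow_mul_pow_eq_one_of_pairTransform_ne_zero {k l : ℕ} {S : Finset (ZMod p × ZMod p)}
    (hS : ∀ u : (ZMod p)ˣ, ∀ x ∈ S, ((u : ZMod p) ^ k * x.1, (u : ZMod p) ^ l * x.2) ∈ S)
    {χ₁ χ₂ : DirichletCharacter ℂ p} (h : pairTransform S χ₁ χ₂ ≠ 0) : χ₁ ^ k * χ₂ ^ l = 1 := by
  refine MulChar.ext fun u => ?_
  have hu : (u : ZMod p) ≠ 0 := u.ne_zero
  have key : (χ₁ ^ k * χ₂ ^ l) u * pairTransform S χ₁ χ₂ = pairTransform S χ₁ χ₂ := by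
    conv_lhs => rw [pairTransform, Finset.mul_sum]
    refine Finset.sum_nbij' (fun x => ((u : ZMod p) ^ k * x.1, (u : ZMod p) ^ l * x.2))
      (fun x => (((u⁻¹ : (ZMod p)ˣ) : ZMod p) ^ k * x.1, ((u⁻¹ : (ZMod p)ˣ) : ZMod p) ^ l * x.2))
      (hS u) (hS u⁻¹) ?_ ?_ ?_
    · intro x _
      simp only [← mul_assoc, ← mul_pow, Units.inv_mul, one_pow, one_mul, Prod.mk.eta]
    · intro x _
      simp only [← mul_assoc, ← mul_pow, Units.mul_inv, one_pow, one_mul, Prod.mk.eta]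
    · intro x _
      simp only [map_mul, map_pow, MulChar.mul_apply, MulChar.pow_apply_coe]
      ring
  rw [MulChar.one_apply_coe]
  exact mul_right_cancel₀ h (key.trans (one_mul _).symm)

/-- Parseval in one variable at a time. -/
theorem sum_norm_sq_pairTransform_le (S : Finset (ZMod p × ZMod p)) :
    ∑ x : DirichletCharacter ℂ p × DirichletCharacter ℂ p, ‖pairTransform S x.1 x.2‖ ^ 2 ≤
      ((p : ℝ) - 1) ^ 2 * S.card := by
  classical
  have hp : p.Prime := Fact.out
  have hp1 : (1 : ℝ) ≤ p := by exact_mod_cast hp.one_le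
  have e : ∀ χ₁ χ₂ : DirichletCharacter ℂ p, pairTransform S χ₁ χ₂ =
      ∑ a, χ₁ a * ∑ b, χ₂ b * (if (a, b) ∈ S then 1 else 0) := by
    intro χ₁ χ₂
    simp only [Finset.mul_sum]
    rw [← Fintype.sum_prod_type' (fun a b => χ₁ a * (χ₂ b * (if (a, b) ∈ S then 1 else 0)))]
    simp [pairTransform, Finset.sum_ite_mem, mul_ite]
  rw [Fintype.sum_prod_type, Finset.sum_comm]
  calc ∑ χ₂ : DirichletCharacter ℂ p, ∑ χ₁ : DirichletCharacter ℂ p, ‖pairTransform S χ₁ χ₂‖ ^ 2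
      ≤ ∑ χ₂ : DirichletCharacter ℂ p, ((p : ℝ) - 1) *
          ∑ a, ‖∑ b, χ₂ b * (if (a, b) ∈ S then 1 else 0)‖ ^ 2 := by
        refine Finset.sum_le_sum fun χ₂ _ => ?_
        simp only [e]
        exact sum_norm_sq_charTransform_le _
    _ = ((p : ℝ) - 1) * ∑ a, ∑ χ₂ : DirichletCharacter ℂ p,
          ‖∑ b, χ₂ b * (if (a, b) ∈ S then 1 else 0)‖ ^ 2 := by
        rw [← Finset.mul_sum, Finset.sum_comm]
    _ ≤ ((p : ℝ) - 1) * ∑ a, ((p : ℝ) - 1) * ∑ b, ‖(if (a, b) ∈ S then 1 else 0 : ℂ)‖ ^ 2 := by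
        refine mul_le_mul_of_nonneg_left (Finset.sum_le_sum fun a _ => ?_) (by linarith)
        exact sum_norm_sq_charTransform_le _
    _ = _ := by
        rw [← Finset.mul_sum, ← mul_assoc, ← pow_two,
          ← Fintype.sum_prod_type' (fun a b => ‖(if (a, b) ∈ S then 1 else 0 : ℂ)‖ ^ 2)]
        congr 1
        rw [Finset.card_eq_sum_ones, Nat.cast_sum]
        simp [apply_ite, Finset.sum_ite_mem]

/-- The number of elements of `S` in a box, expanded into characters. -/
theorem sum_pairTransform_mul_boxSum (S : Finset (ZMod p × ZMod p)) (A B : ℕ) :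
    ∑ x : DirichletCharacter ℂ p × DirichletCharacter ℂ p,
      pairTransform S x.1 x.2 * (boxSum x.1⁻¹ A * boxSum x.2⁻¹ B) =
      ((p : ℂ) - 1) ^ 2 *
        ((S.filter fun x => x.1 ∈ signedBox p A ∧ x.2 ∈ signedBox p B).card : ℂ) := by
  classical
  have h1 : ∀ (M : ℕ) (a : ZMod p), ∑ χ : DirichletCharacter ℂ p, χ a * boxSum χ⁻¹ M =
      if a ∈ signedBox p M then ((p : ℂ) - 1) else 0 := by
    intro M a
    simp only [boxSum, Finset.mul_sum]
    rw [Finset.sum_comm]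
    have : ∀ y ∈ signedBox p M, ∑ χ : DirichletCharacter ℂ p, χ a * χ⁻¹ y =
        if y = a then ((p : ℂ) - 1) else 0 := by
      intro y hy
      rw [Finset.sum_congr rfl fun χ _ => mul_comm (χ a) (χ⁻¹ y), sum_inv_char_mul_char]
      simp only [ne_eq, (mem_signedBox.1 hy).1, not_false_eq_true, true_and]
    rw [Finset.sum_congr rfl this, Finset.sum_ite_eq']
  calc _ = ∑ y ∈ S, (∑ χ : DirichletCharacter ℂ p, χ y.1 * boxSum χ⁻¹ A) *
        ∑ χ : DirichletCharacter ℂ p, χ y.2 * boxSum χ⁻¹ B := by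
        unfold pairTransform
        rw [Finset.sum_congr rfl fun x _ => Finset.sum_mul _ _ _, Finset.sum_comm]
        refine Finset.sum_congr rfl fun y _ => ?_
        rw [Finset.sum_mul_sum, Fintype.sum_prod_type]
        refine Finset.sum_congr rfl fun χ₁ _ => Finset.sum_congr rfl fun χ₂ _ => ?_
        ring
    _ = _ := by
        simp only [h1]
        rw [Finset.card_filter, Nat.cast_sum, Finset.mul_sum]
        refine Finset.sum_congr rfl fun y _ => ?_
        by_cases ha : y.1 ∈ signedBox p A <;> by_cases hb : y.2 ∈ signedBox p B <;>
          simp [ha, hb, pow_two]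

open scoped Classical in
/-- The surviving pairs of characters with nonprincipal first component. -/
def charPairs (p : ℕ) [Fact p.Prime] (k l : ℕ) :
    Finset (DirichletCharacter ℂ p × DirichletCharacter ℂ p) :=
  Finset.univ.filter fun x => x.1 ≠ 1 ∧ x.1 ^ k * x.2 ^ l = 1

open scoped Classical in
/-- The nonprincipal characters of exponent `l`. -/
def torsionChars (p : ℕ) [Fact p.Prime] (l : ℕ) : Finset (DirichletCharacter ℂ p) :=
  Finset.univ.filter fun χ => χ ≠ 1 ∧ χ ^ l = 1

/-- The pair (1, 1) is the main term. For pairs (1, χ) the transform is bounded by #S ≤ (p - 1)²;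
for charPairs Cauchy–Schwarz and Parseval supply the same (p - 1)², which cancels the normalisation.
The factors 4 come from the two signs in each box. -/
theorem abs_card_filter_sub_le {k l A B : ℕ} (hA : A ≤ (p - 1) / 2) (hB : B ≤ (p - 1) / 2)
    {S : Finset (ZMod p × ZMod p)} (h0 : ∀ x ∈ S, x.1 ≠ 0 ∧ x.2 ≠ 0)
    (hS : ∀ u : (ZMod p)ˣ, ∀ x ∈ S, ((u : ZMod p) ^ k * x.1, (u : ZMod p) ^ l * x.2) ∈ S) :
    |((S.filter fun x => x.1 ∈ signedBox p A ∧ x.2 ∈ signedBox p B).card : ℝ) -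
        4 * A * B / ((p : ℝ) - 1) ^ 2 * S.card| ≤
      4 * A * ∑ χ ∈ torsionChars p l, ‖charSum χ B‖ +
      4 * √(∑ x ∈ charPairs p k l, ‖charSum x.1 A‖ ^ 2 * ‖charSum x.2 B‖ ^ 2) := by
  classical
  have hp : p.Prime := Fact.out
  have hp1 : (1 : ℝ) < p := by exact_mod_cast hp.one_lt
  have hq : (0 : ℝ) < (p : ℝ) - 1 := by linarith
  set N : ℝ := ((S.filter fun x => x.1 ∈ signedBox p A ∧ x.2 ∈ signedBox p B).card : ℝ) with hN
  set G : DirichletCharacter ℂ p × DirichletCharacter ℂ p → ℂ := fun x =>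
    pairTransform S x.1 x.2 * (boxSum x.1⁻¹ A * boxSum x.2⁻¹ B) with hG
  have hcard : (S.card : ℝ) ≤ ((p : ℝ) - 1) ^ 2 := by
    have : S.card ≤ (p - 1) ^ 2 := by
      calc S.card ≤ ((Finset.univ.erase (0 : ZMod p)) ×ˢ (Finset.univ.erase (0 : ZMod p))).card :=
            Finset.card_le_card fun x hx => by simpa using h0 x hx
        _ = (p - 1) ^ 2 := by
            rw [Finset.card_product, Finset.card_erase_of_mem (Finset.mem_univ _),
              Finset.card_univ, ZMod.card, pow_two]
    calc (S.card : ℝ) ≤ ((p - 1 : ℕ) : ℝ) ^ 2 := by exact_mod_cast this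
      _ = _ := by rw [Nat.cast_sub hp.one_le, Nat.cast_one]
  have hG1 : G (1, 1) = 4 * A * B * S.card := by
    have : pairTransform S 1 1 = S.card := by
      rw [pairTransform, Finset.sum_congr rfl (g := fun _ => (1 : ℂ))]
      · simp
      · intro x hx
        rw [MulChar.one_apply (isUnit_iff_ne_zero.2 (h0 x hx).1),
          MulChar.one_apply (isUnit_iff_ne_zero.2 (h0 x hx).2), one_mul]
    simp only [hG, this, inv_one, boxSum_one hA, boxSum_one hB]
    ring
  have hsum : ((p : ℂ) - 1) ^ 2 * N - 4 * A * B * S.card = ∑ x ∈ Finset.univ.erase (1, 1), G x := by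
    have := sum_pairTransform_mul_boxSum S A B
    rw [← hG1, hN, Complex.ofReal_natCast, ← this, ← Finset.add_sum_erase _ _ (Finset.mem_univ
      ((1 : DirichletCharacter ℂ p), (1 : DirichletCharacter ℂ p)))]
    simp [hG]
  have hT : ∀ x ∈ Finset.univ.erase (1, 1), G x ≠ 0 →
      x ∈ (torsionChars p l).image (fun χ => (1, χ)) ∪ charPairs p k l := by
    intro x hx hx0
    have h1 := pow_mul_pow_eq_one_of_pairTransform_ne_zero hS (left_ne_zero_of_mul hx0)
    rw [Finset.mem_union]
    by_cases hx1 : x.1 = 1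
    · left
      rw [hx1, one_pow, one_mul] at h1
      refine Finset.mem_image.2 ⟨x.2, ?_, Prod.ext hx1.symm rfl⟩
      simp only [torsionChars, Finset.mem_filter, Finset.mem_univ, true_and]
      exact ⟨fun h2 => Finset.ne_of_mem_erase hx (Prod.ext hx1 h2), h1⟩
    · right
      simp only [charPairs, Finset.mem_filter, Finset.mem_univ, true_and]
      exact ⟨hx1, h1⟩
  have hb1 : ∑ x ∈ (torsionChars p l).image (fun χ => ((1 : DirichletCharacter ℂ p), χ)), ‖G x‖ ≤
      ((p : ℝ) - 1) ^ 2 * (4 * A * ∑ χ ∈ torsionChars p l, ‖charSum χ B‖) := by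
    rw [Finset.sum_image (fun a _ b _ h => (Prod.ext_iff.1 h).2), Finset.mul_sum, Finset.mul_sum]
    refine Finset.sum_le_sum fun χ _ => ?_
    simp only [hG, inv_one, boxSum_one hA, norm_mul]
    calc _ ≤ ((p : ℝ) - 1) ^ 2 * (2 * A * (2 * ‖charSum χ B‖)) := by
          gcongr
          · exact (norm_pairTransform_le _ _ _).trans hcard
          · simp
          · simp
          · exact norm_boxSum_inv_le hB χ
      _ = _ := by ring
  have hb2 : ∑ x ∈ charPairs p k l, ‖G x‖ ≤ ((p : ℝ) - 1) ^ 2 *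
      (4 * √(∑ x ∈ charPairs p k l, ‖charSum x.1 A‖ ^ 2 * ‖charSum x.2 B‖ ^ 2)) := by
    calc ∑ x ∈ charPairs p k l, ‖G x‖
        ≤ ∑ x ∈ charPairs p k l, 4 *
            (‖pairTransform S x.1 x.2‖ * (‖charSum x.1 A‖ * ‖charSum x.2 B‖)) := by
          refine Finset.sum_le_sum fun x _ => ?_
          simp only [hG, norm_mul]
          calc _ ≤ ‖pairTransform S x.1 x.2‖ * (2 * ‖charSum x.1 A‖ * (2 * ‖charSum x.2 B‖)) := by
                gcongr
                · exact norm_boxSum_inv_le hA _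
                · exact norm_boxSum_inv_le hB _
            _ = _ := by ring
      _ ≤ 4 * (√(∑ x ∈ charPairs p k l, ‖pairTransform S x.1 x.2‖ ^ 2) *
            √(∑ x ∈ charPairs p k l, (‖charSum x.1 A‖ * ‖charSum x.2 B‖) ^ 2)) := by
          rw [← Finset.mul_sum]
          gcongr
          exact Real.sum_mul_le_sqrt_mul_sqrt _ _ _
      _ ≤ 4 * (((p : ℝ) - 1) ^ 2 *
            √(∑ x ∈ charPairs p k l, (‖charSum x.1 A‖ * ‖charSum x.2 B‖) ^ 2)) := by
          gcongr
          refine Real.sqrt_le_iff.2 ⟨by positivity, ?_⟩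
          calc _ ≤ ∑ x : DirichletCharacter ℂ p × DirichletCharacter ℂ p,
                ‖pairTransform S x.1 x.2‖ ^ 2 :=
                Finset.sum_le_sum_of_subset_of_nonneg (Finset.subset_univ _)
                  (fun _ _ _ => by positivity)
            _ ≤ _ := sum_norm_sq_pairTransform_le S
            _ ≤ ((p : ℝ) - 1) ^ 2 * ((p : ℝ) - 1) ^ 2 := by gcongr
            _ = _ := by ring
      _ = _ := by
          simp only [mul_pow]
          ring
  have hnorm : ((p : ℝ) - 1) ^ 2 * |N - 4 * A * B / ((p : ℝ) - 1) ^ 2 * S.card| =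
      ‖∑ x ∈ Finset.univ.erase (1, 1), G x‖ := by
    rw [← hsum]
    have : ((p : ℂ) - 1) ^ 2 * N - 4 * A * B * S.card =
        ((((p : ℝ) - 1) ^ 2 * (N - 4 * A * B / ((p : ℝ) - 1) ^ 2 * S.card) : ℝ) : ℂ) := by
      have e : ((p : ℝ) - 1) ^ 2 * (N - 4 * A * B / ((p : ℝ) - 1) ^ 2 * S.card) =
          ((p : ℝ) - 1) ^ 2 * N - 4 * A * B * S.card := by
        field_simp
      rw [e]
      push_cast
      ring
    rw [this, Complex.norm_real, Real.norm_eq_abs, abs_mul, abs_of_nonneg (sq_nonneg ((p : ℝ) - 1))]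
  refine le_of_mul_le_mul_left ?_ (by positivity : 0 < ((p : ℝ) - 1) ^ 2)
  rw [hnorm, mul_add]
  calc _ ≤ ∑ x ∈ Finset.univ.erase (1, 1), ‖G x‖ := norm_sum_le _ _
    _ ≤ ∑ x ∈ (torsionChars p l).image (fun χ => (1, χ)) ∪ charPairs p k l, ‖G x‖ := by
        rw [← Finset.sum_filter_ne_zero]
        refine Finset.sum_le_sum_of_subset_of_nonneg (fun x hx => ?_) (fun _ _ _ => norm_nonneg _)
        obtain ⟨hx1, hx2⟩ := Finset.mem_filter.1 hx
        exact hT x hx1 (norm_ne_zero_iff.1 hx2)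
    _ ≤ ∑ x ∈ (torsionChars p l).image (fun χ => ((1 : DirichletCharacter ℂ p), χ)), ‖G x‖ +
          ∑ x ∈ charPairs p k l, ‖G x‖ := by
        rw [← Finset.sum_union_inter]
        exact le_add_of_nonneg_right (Finset.sum_nonneg fun _ _ => norm_nonneg _)
    _ ≤ _ := add_le_add hb1 hb2

/-! ### Counting characters through cyclicity of the dual group -/

instance : IsCyclic (DirichletCharacter ℂ p) :=
  (DirichletCharacter.mulEquiv_units ℂ p).some.isCyclic.2 inferInstance

-- If nonempty, the solution set is a coset of the k-torsion, which has at most k elements in a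
-- cyclic group.
open scoped Classical in
theorem card_filter_pow_eq_le {k : ℕ} (hk : 0 < k) (c : DirichletCharacter ℂ p) :
    ((Finset.univ.filter fun χ : DirichletCharacter ℂ p => χ ^ k = c).card : ℝ) ≤ k := by
  norm_cast
  rcases (Finset.univ.filter fun χ : DirichletCharacter ℂ p => χ ^ k = c).eq_empty_or_nonempty
    with h | ⟨χ₀, h⟩
  · rw [h]
    simp
  · refine le_trans ?_ (IsCyclic.card_pow_eq_one_le (α := DirichletCharacter ℂ p) hk)
    refine Finset.card_le_card_of_injOn (fun χ => χ * χ₀⁻¹) (fun χ hχ => ?_)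
      (fun a _ b _ hab => mul_right_cancel hab)
    have h1 := (Finset.mem_filter.1 h).2
    have h2 := (Finset.mem_filter.1 hχ).2
    simp [mul_pow, h1, h2]

/-- Given the second component, the first is a solution of χ^k = c, so each term is repeated at most
k times. The second component may be principal, hence the full sum on the right. -/
theorem sum_charPairs_snd_le {k : ℕ} (hk : 0 < k) (l : ℕ) {f : DirichletCharacter ℂ p → ℝ}
    (hf : ∀ χ, 0 ≤ f χ) : ∑ x ∈ charPairs p k l, f x.2 ≤ k * ∑ χ, f χ := by
  classical
  rw [charPairs, Finset.sum_filter, Fintype.sum_prod_type_right, Finset.mul_sum]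
  refine Finset.sum_le_sum fun b _ => ?_
  rw [← Finset.sum_filter]
  dsimp only
  rw [Finset.sum_const, nsmul_eq_mul]
  refine mul_le_mul_of_nonneg_right (le_trans ?_ (card_filter_pow_eq_le hk (b ^ l)⁻¹)) (hf b)
  norm_cast
  refine Finset.card_le_card fun a ha => ?_
  rw [Finset.mem_filter] at ha ⊢
  exact ⟨ha.1, eq_inv_of_mul_eq_one_left ha.2.2⟩

open scoped Classical in
theorem sum_charPairs_fst_le (k : ℕ) {l : ℕ} (hl : 0 < l) {f : DirichletCharacter ℂ p → ℝ}
    (hf : ∀ χ, 0 ≤ f χ) : ∑ x ∈ charPairs p k l, f x.1 ≤ l * ∑ χ ∈ Finset.univ.erase 1, f χ := by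
  rw [charPairs, Finset.sum_filter, Fintype.sum_prod_type, ← Finset.add_sum_erase _ _
    (Finset.mem_univ 1), Finset.mul_sum]
  simp only [ne_eq, not_true_eq_false, false_and, if_false, Finset.sum_const_zero, zero_add]
  refine Finset.sum_le_sum fun a _ => ?_
  rw [← Finset.sum_filter, Finset.sum_const, nsmul_eq_mul]
  refine mul_le_mul_of_nonneg_right (le_trans ?_ (card_filter_pow_eq_le hl (a ^ k)⁻¹)) (hf a)
  norm_cast
  refine Finset.card_le_card fun b hb => ?_
  rw [Finset.mem_filter] at hb ⊢
  exact ⟨hb.1, eq_inv_of_mul_eq_one_right hb.2.2⟩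

/-- The character group has order p - 1, so χ^l = 1 already gives χ^{gcd(p-1, l)} = 1, the condition
in σ and ρ. -/
theorem sum_torsionChars_le {l : ℕ} (hl : 0 < l) (B : ℕ) :
    ∑ χ ∈ torsionChars p l, ‖charSum χ B‖ ≤ l * charSumMax p (Nat.gcd (p - 1) l) B := by
  classical
  have hp : p.Prime := Fact.out
  have hmax := (isGreatest_charSumMax p (Nat.gcd (p - 1) l) B).2
  have h1 : 1 ≤ charSumMax p (Nat.gcd (p - 1) l) B := hmax (Set.mem_insert _ _)
  calc _ ≤ ∑ χ ∈ torsionChars p l, charSumMax p (Nat.gcd (p - 1) l) B := by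
        refine Finset.sum_le_sum fun χ hχ => hmax (Or.inr ⟨χ, ?_⟩)
        simp only [torsionChars, Finset.mem_filter, Finset.mem_univ, true_and] at hχ
        refine ⟨hχ.1, ?_, rfl⟩
        have h2 : χ ^ (p - 1) = 1 := by
          have h3 := DirichletCharacter.card_eq_totient_of_hasEnoughRootsOfUnity ℂ p
          rw [Nat.totient_prime hp] at h3
          rw [← h3]
          exact pow_card_eq_one'
        exact pow_gcd_eq_one.2 ⟨h2, hχ.2⟩
    _ = (torsionChars p l).card * charSumMax p (Nat.gcd (p - 1) l) B := by
        rw [Finset.sum_const, nsmul_eq_mul]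
    _ ≤ _ := by
        refine mul_le_mul_of_nonneg_right (le_trans ?_ (card_filter_pow_eq_le (p := p) hl 1))
          (by linarith)
        norm_cast
        refine Finset.card_le_card fun b hb => ?_
        rw [torsionChars, Finset.mem_filter] at hb
        exact Finset.mem_filter.2 ⟨hb.1, hb.2.2⟩

end PairExpansion

/-! ### The two error bounds for invariant sets -/

theorem one_le_log {p : ℕ} (hp3 : 3 < p) : 1 ≤ Real.log p := by
  rw [Real.le_log_iff_exp_le (by positivity)]
  have h3 : (4 : ℝ) ≤ p := by exact_mod_cast hp3
  linarith [Real.exp_one_lt_d9]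

section Bounds

variable {p : ℕ} [Fact p.Prime]

/-- Pólya–Vinogradov applies pointwise to the nonprincipal first component; the second is averaged
in mean square. -/
theorem sqrt_sum_charPairs_le_log {k l A B : ℕ} (hk : 0 < k) (hk6 : k ≤ 6) (hp3 : 3 < p)
    (hA : A ≤ (p - 1) / 2) (hB : B ≤ (p - 1) / 2) :
    √(∑ x ∈ charPairs p k l, ‖charSum x.1 A‖ ^ 2 * ‖charSum x.2 B‖ ^ 2) ≤
      6 * ((B : ℝ) ^ (1 / 2 : ℝ) * p * Real.log p) := by
  have hlog := one_le_log hp3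
  have hk6' : (k : ℝ) ≤ 6 := by exact_mod_cast hk6
  refine Real.sqrt_le_iff.2 ⟨by positivity, ?_⟩
  calc _ ≤ ∑ x ∈ charPairs p k l, (√p * (1 + Real.log p)) ^ 2 * ‖charSum x.2 B‖ ^ 2 := by
        refine Finset.sum_le_sum fun x hx => ?_
        simp only [charPairs, Finset.mem_filter] at hx
        gcongr
        exact norm_charSum_le (by omega) (by omega) hx.2.1
    _ ≤ (√p * (1 + Real.log p)) ^ 2 * (k * (p * B)) := by
        rw [← Finset.mul_sum]
        gcongr
        refine (sum_charPairs_snd_le hk l (f := fun χ => ‖charSum χ B‖ ^ 2)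
          (fun _ => by positivity)).trans ?_
        gcongr
        exact sum_norm_sq_charSum_le (by omega)
    _ ≤ (√p * (2 * Real.log p)) ^ 2 * (6 * (p * B)) := by
        gcongr
        linarith
    _ = 24 * (B * p ^ 2 * Real.log p ^ 2) := by
        rw [mul_pow, Real.sq_sqrt (by positivity)]
        ring
    _ ≤ 36 * (B * p ^ 2 * Real.log p ^ 2) := by
        gcongr
        norm_num
    _ = _ := by
        rw [← Real.sqrt_eq_rpow, mul_pow, mul_pow, mul_pow, Real.sq_sqrt (by positivity)]
        ring

/-- Cauchy–Schwarz separates the two components into fourth moments. Only the second one carries the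
principal contribution B⁴. -/
theorem sqrt_sum_charPairs_le_lossFactor {k l A B : ℕ} (hk : 0 < k) (hk6 : k ≤ 6) (hl : 0 < l)
    (hl6 : l ≤ 6) (hp3 : 3 < p) (hA : A ≤ (p - 1) / 2) (hB : B ≤ (p - 1) / 2) :
    √(∑ x ∈ charPairs p k l, ‖charSum x.1 A‖ ^ 2 * ‖charSum x.2 B‖ ^ 2) ≤
      20 * (((A : ℝ) ^ (1 / 2 : ℝ) * B * (p : ℝ) ^ (1 / 4 : ℝ) +
        (A : ℝ) ^ (1 / 2 : ℝ) * (B : ℝ) ^ (1 / 2 : ℝ) * (p : ℝ) ^ (1 / 2 : ℝ)) *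
          lossFactor p) := by
  classical
  have hk6' : (k : ℝ) ≤ 6 := by exact_mod_cast hk6
  have hl6' : (l : ℝ) ≤ 6 := by exact_mod_cast hl6
  have hG := one_le_lossFactor (p := p) (by omega)
  set G := lossFactor p
  set a := (A : ℝ) ^ (1 / 2 : ℝ) with ha
  set b := (B : ℝ) ^ (1 / 2 : ℝ) with hb
  set q := (p : ℝ) ^ (1 / 4 : ℝ) with hq
  have ha0 : 0 ≤ a := by positivity
  have hb0 : 0 ≤ b := by positivity
  have hq0 : 0 ≤ q := by positivity
  have ha2 : (A : ℝ) = a ^ 2 := by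
    rw [ha, ← Real.sqrt_eq_rpow, Real.sq_sqrt (by positivity)]
  have hb2 : (B : ℝ) = b ^ 2 := by
    rw [hb, ← Real.sqrt_eq_rpow, Real.sq_sqrt (by positivity)]
  have hq4 : (p : ℝ) = q ^ 4 := by
    rw [hq, ← Real.rpow_natCast, ← Real.rpow_mul (by positivity)]
    norm_num
  have hq2 : (p : ℝ) ^ (1 / 2 : ℝ) = q ^ 2 := by
    rw [hq, ← Real.rpow_natCast, ← Real.rpow_mul (by positivity)]
    norm_num
  have h1 : ∑ x ∈ charPairs p k l, (‖charSum x.1 A‖ ^ 2) ^ 2 ≤ 6 * (64 * (p * A ^ 2 * G)) := by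
    have := sum_charPairs_fst_le (p := p) k hl (f := fun χ => ‖charSum χ A‖ ^ 4)
      (fun _ => by positivity)
    simp only [← pow_mul]
    refine this.trans ?_
    gcongr
    exact sum_norm_pow_four_charSum_le (by omega) (by omega)
  have h2 : ∑ x ∈ charPairs p k l, (‖charSum x.2 B‖ ^ 2) ^ 2 ≤
      6 * (B ^ 4 + 64 * (p * B ^ 2 * G)) := by
    have := sum_charPairs_snd_le (p := p) hk l (f := fun χ => ‖charSum χ B‖ ^ 4)
      (fun _ => by positivity)
    simp only [← pow_mul]
    refine this.trans ?_
    gcongr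
    exact sum_univ_norm_pow_four_charSum_le (by omega) (by omega)
  refine Real.sqrt_le_iff.2 ⟨by positivity, ?_⟩
  refine le_of_sq_le_sq ?_ (by positivity)
  refine (Finset.sum_mul_sq_le_sq_mul_sq _ _ _).trans ?_
  rw [hq2]
  calc _ ≤ 6 * (64 * (p * A ^ 2 * G)) * (6 * (B ^ 4 + 64 * (p * B ^ 2 * G))) :=
        mul_le_mul h1 h2 (Finset.sum_nonneg fun _ _ => by positivity) (by positivity)
    _ ≤ 6 * (64 * (p * A ^ 2 * G)) * (6 * (64 * B ^ 4 * G + 64 * (p * B ^ 2 * G))) := by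
        gcongr
        nlinarith [show (0 : ℝ) ≤ (B : ℝ) ^ 4 by positivity]
    -- Here 147456 = (6 · 64)², rounded up to 160000 = 20⁴; raising G² to G⁴ makes the bound a
    -- perfect fourth power.
    _ = 147456 * ((q * a * b ^ 2) ^ 4 + (q ^ 2 * a * b) ^ 4) * G ^ 2 := by
        rw [hq4, ha2, hb2]
        ring
    _ ≤ 160000 * (q * a * b ^ 2 + q ^ 2 * a * b) ^ 4 * G ^ 4 := by
        gcongr
        · norm_num
        · exact pow_add_pow_le (by positivity) (by positivity) (by norm_num)
        · norm_num
    _ = _ := by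
        rw [hb2]
        ring

/-- The discrepancy in a box of a set of pairs that is invariant under a weighted action of the
multiplicative group. -/
theorem abs_card_filter_sub_le_errors {k l A B : ℕ} (hk : 0 < k) (hk6 : k ≤ 6) (hl : 0 < l)
    (hl6 : l ≤ 6) (hp3 : 3 < p) (hA : A ≤ (p - 1) / 2) (hB : B ≤ (p - 1) / 2)
    {S : Finset (ZMod p × ZMod p)} (h0 : ∀ x ∈ S, x.1 ≠ 0 ∧ x.2 ≠ 0)
    (hS : ∀ u : (ZMod p)ˣ, ∀ x ∈ S, ((u : ZMod p) ^ k * x.1, (u : ZMod p) ^ l * x.2) ∈ S) :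
    |((S.filter fun x => x.1 ∈ signedBox p A ∧ x.2 ∈ signedBox p B).card : ℝ) -
        4 * A * B / ((p : ℝ) - 1) ^ 2 * S.card| ≤
      24 * (A * charSumMax p (Nat.gcd (p - 1) l) B) +
        80 * (((A : ℝ) ^ (1 / 2 : ℝ) * B * (p : ℝ) ^ (1 / 4 : ℝ) +
          (A : ℝ) ^ (1 / 2 : ℝ) * (B : ℝ) ^ (1 / 2 : ℝ) * (p : ℝ) ^ (1 / 2 : ℝ)) *
            lossFactor p) ∧
    |((S.filter fun x => x.1 ∈ signedBox p A ∧ x.2 ∈ signedBox p B).card : ℝ) -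
        4 * A * B / ((p : ℝ) - 1) ^ 2 * S.card| ≤
      24 * (A * charSumMax p (Nat.gcd (p - 1) l) B) +
        24 * ((B : ℝ) ^ (1 / 2 : ℝ) * p * Real.log p) := by
  have h := abs_card_filter_sub_le hA hB h0 hS
  have h1 := sqrt_sum_charPairs_le_lossFactor (k := k) (l := l) hk hk6 hl hl6 hp3 hA hB
  have h2 := sqrt_sum_charPairs_le_log (k := k) (l := l) hk hk6 hp3 hA hB
  have hmax : 1 ≤ charSumMax p (Nat.gcd (p - 1) l) B :=
    (isGreatest_charSumMax p (Nat.gcd (p - 1) l) B).2 (Set.mem_insert _ _)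
  have h3 : 4 * A * ∑ χ ∈ torsionChars p l, ‖charSum χ B‖ ≤
      24 * (A * charSumMax p (Nat.gcd (p - 1) l) B) := by
    calc 4 * A * ∑ χ ∈ torsionChars p l, ‖charSum χ B‖
        ≤ 4 * A * (6 * charSumMax p (Nat.gcd (p - 1) l) B) := by
          gcongr
          refine (sum_torsionChars_le hl B).trans ?_
          gcongr
          exact_mod_cast hl6
      _ = _ := by ring
  constructor <;> linarith

end Bounds

/-! ### Twists of curves and degenerate coefficient pairs -/

section Curves

variable {p : ℕ} [Fact p.Prime]

theorem isElliptic_curve_of_ne_zero (hp3 : 3 < p) {a b : ZMod p}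
    (h : 4 * a ^ 3 + 27 * b ^ 2 ≠ 0) : (curve a b).IsElliptic := by
  have hp : p.Prime := Fact.out
  rw [WeierstrassCurve.isElliptic_iff, isUnit_iff_ne_zero]
  have e : (curve a b).Δ = -2 ^ 4 * (4 * a ^ 3 + 27 * b ^ 2) := by
    simp only [curve, WeierstrassCurve.Δ, WeierstrassCurve.b₂, WeierstrassCurve.b₄,
      WeierstrassCurve.b₆, WeierstrassCurve.b₈]
    ring
  have h2 : (2 : ZMod p) ≠ 0 := by
    have : ((2 : ℕ) : ZMod p) ≠ 0 := by
      rw [Ne, ZMod.natCast_eq_zero_iff]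
      exact fun hd => by have := Nat.le_of_dvd two_pos hd; omega
    simpa using this
  rw [e]
  exact mul_ne_zero (neg_ne_zero.2 (pow_ne_zero _ h2)) h

theorem isomorphic_twist (hp3 : 3 < p) {a b : ZMod p} (h : 4 * a ^ 3 + 27 * b ^ 2 ≠ 0)
    (u : (ZMod p)ˣ) : Isomorphic ((u : ZMod p) ^ 4 * a) ((u : ZMod p) ^ 6 * b) a b := by
  -- A change of variables with unit v scales the coefficients by v⁻⁴ and v⁻⁶, hence v = u⁻¹.
  refine ⟨isElliptic_curve_of_ne_zero hp3 ?_, isElliptic_curve_of_ne_zero hp3 h,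
    ⟨u⁻¹, 0, 0, 0⟩, ?_⟩
  · have : 4 * ((u : ZMod p) ^ 4 * a) ^ 3 + 27 * ((u : ZMod p) ^ 6 * b) ^ 2 =
        (u : ZMod p) ^ 12 * (4 * a ^ 3 + 27 * b ^ 2) := by ring
    rw [this]
    exact mul_ne_zero (pow_ne_zero _ u.ne_zero) h
  · ext <;> simp [curve, WeierstrassCurve.variableChange_def]

/-- A pair of nonzero coefficients of a nonsingular curve. -/
def IsGeneric (x : ZMod p × ZMod p) : Prop :=
  x.1 ≠ 0 ∧ x.2 ≠ 0 ∧ 4 * x.1 ^ 3 + 27 * x.2 ^ 2 ≠ 0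

-- The two axes account for #I + #J pairs. On the discriminant curve each a admits at most two
-- values ±b, because 27 is invertible.
open scoped Classical in
theorem card_filter_not_isGeneric_le (hp3 : 3 < p) (I J : Finset (ZMod p)) :
    ((I ×ˢ J).filter fun x => ¬ IsGeneric x).card ≤ 3 * I.card + J.card := by
  have hp : p.Prime := Fact.out
  have h27 : (27 : ZMod p) ≠ 0 := by
    have : ((3 ^ 3 : ℕ) : ZMod p) ≠ 0 := by
      rw [Ne, ZMod.natCast_eq_zero_iff]
      exact fun hd => by have := Nat.le_of_dvd (by norm_num) (hp.dvd_of_dvd_pow hd); omega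
    norm_num at this
    exact this
  set T := (I ×ˢ J).filter fun x => 4 * x.1 ^ 3 + 27 * x.2 ^ 2 = 0 with hT
  have hsub : ((I ×ˢ J).filter fun x => ¬ IsGeneric x) ⊆
      (J.image (fun b => (0, b)) ∪ I.image (fun a => (a, 0))) ∪ T := by
    intro x hx
    obtain ⟨hx1, hx2⟩ := Finset.mem_filter.1 hx
    obtain ⟨hI, hJ⟩ := Finset.mem_product.1 hx1
    simp only [Finset.mem_union, Finset.mem_image, hT, Finset.mem_filter]
    by_cases ha : x.1 = 0
    · exact Or.inl (Or.inl ⟨x.2, hJ, Prod.ext ha.symm rfl⟩)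
    · by_cases hb : x.2 = 0
      · exact Or.inl (Or.inr ⟨x.1, hI, Prod.ext rfl hb.symm⟩)
      · refine Or.inr ⟨hx1, ?_⟩
        by_contra hd
        exact hx2 ⟨ha, hb, hd⟩
  have hTc : T.card ≤ 2 * I.card := by
    refine (Finset.card_le_mul_card_image (f := Prod.fst) T 2 fun a _ => ?_).trans
      (Nat.mul_le_mul_left 2 (Finset.card_le_card fun a ha => ?_))
    · rcases (T.filter fun x => x.1 = a).eq_empty_or_nonempty with h | ⟨y, hy⟩
      · simp [h]
      · refine (Finset.card_le_card (t := {(a, y.2), (a, -y.2)}) fun x hx => ?_).trans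
          Finset.card_le_two
        obtain ⟨hx1, hx2⟩ := Finset.mem_filter.1 hx
        obtain ⟨hy1, hy2⟩ := Finset.mem_filter.1 hy
        have hx3 := (Finset.mem_filter.1 hx1).2
        have hy3 := (Finset.mem_filter.1 hy1).2
        rw [hx2] at hx3
        rw [hy2] at hy3
        have hsq : x.2 ^ 2 = y.2 ^ 2 := by
          refine mul_left_cancel₀ h27 ?_
          linear_combination hx3 - hy3
        rw [Finset.mem_insert, Finset.mem_singleton]
        rcases sq_eq_sq_iff_eq_or_eq_neg.1 hsq with h | h
        · exact Or.inl (Prod.ext hx2 h)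
        · exact Or.inr (Prod.ext hx2 h)
    · obtain ⟨x, hx, rfl⟩ := Finset.mem_image.1 ha
      exact (Finset.mem_product.1 (Finset.mem_filter.1 hx).1).1
  calc _ ≤ _ := Finset.card_le_card hsub
    _ ≤ (J.card + I.card) + 2 * I.card := by
        refine (Finset.card_union_le _ _).trans (add_le_add ?_ hTc)
        exact (Finset.card_union_le _ _).trans
          (add_le_add Finset.card_image_le Finset.card_image_le)
    _ = _ := by ring

theorem card_filter_valMinAbs_le {M : ℕ} (hM1 : 1 ≤ M) (hM : M ≤ (p - 1) / 2) :
    ((Finset.univ : Finset (ZMod p)).filter fun x => |x.valMinAbs| ≤ (M : ℤ)).card ≤ 3 * M := by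
  classical
  calc _ ≤ (insert 0 (signedBox p M)).card := Finset.card_le_card fun x hx => by
        rw [Finset.mem_insert, mem_signedBox]
        exact (eq_or_ne x 0).imp_right fun h => ⟨h, (Finset.mem_filter.1 hx).2⟩
    _ ≤ (signedBox p M).card + 1 := Finset.card_insert_le _ _
    _ ≤ 3 * M := by
        rw [card_signedBox hM]
        omega

open scoped Classical in
/-- Removing the degenerate pairs and replacing `p` by `p - 1` in the main term costs
`O(A + B)`. -/
theorem abs_boxCount_sub_le {A B : ℕ} (hp3 : 3 < p) (hA1 : 1 ≤ A) (hA : A ≤ (p - 1) / 2)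
    (hB1 : 1 ≤ B) (hB : B ≤ (p - 1) / 2) (S : Finset (ZMod p × ZMod p)) :
    |(boxCount S A B : ℝ) - 4 * A * B / (p : ℝ) ^ 2 * S.card| ≤
      |(((S.filter IsGeneric).filter
          fun x => x.1 ∈ signedBox p A ∧ x.2 ∈ signedBox p B).card : ℝ) -
        4 * A * B / ((p : ℝ) - 1) ^ 2 * (S.filter IsGeneric).card| + 17 * ((A : ℝ) + B) := by
  have hp : p.Prime := Fact.out
  have hp1 : (3 : ℝ) < p := by exact_mod_cast hp3
  set N := ((S.filter IsGeneric).filter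
    fun x => x.1 ∈ signedBox p A ∧ x.2 ∈ signedBox p B).card with hN
  set s := (S.filter IsGeneric).card with hs
  set r := (S.filter fun x => ¬ IsGeneric x).card with hr
  set m := ((S.filter fun x => ¬ IsGeneric x).filter
    fun x => |x.1.valMinAbs| ≤ (A : ℤ) ∧ |x.2.valMinAbs| ≤ (B : ℤ)).card with hm
  have hsr : S.card = s + r := (Finset.card_filter_add_card_filter_not _).symm
  have hbox : boxCount S A B = N + m := by
    rw [boxCount, ← Finset.card_filter_add_card_filter_not (p := IsGeneric), hN, hm]
    congr 1
    · rw [Finset.filter_comm]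
      refine congrArg Finset.card (Finset.filter_congr fun x hx => ?_)
      have := (Finset.mem_filter.1 hx).2
      rw [mem_signedBox, mem_signedBox]
      simp only [this.1, this.2.1, ne_eq, not_false_eq_true, true_and]
    · rw [Finset.filter_comm]
  have hr4 : r ≤ 4 * p := by
    have h := card_filter_not_isGeneric_le hp3 (Finset.univ : Finset (ZMod p)) Finset.univ
    rw [Finset.card_univ, ZMod.card] at h
    have : r ≤ _ := Finset.card_le_card (t := (Finset.univ ×ˢ Finset.univ).filter
      fun x : ZMod p × ZMod p => ¬ IsGeneric x) fun x hx => by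
        simpa using (Finset.mem_filter.1 hx).2
    omega
  -- The bound 3#I + #J with #I ≤ 3A and #J ≤ 3B.
  have hm9 : m ≤ 9 * A + 3 * B := by
    have h := card_filter_not_isGeneric_le hp3
      ((Finset.univ : Finset (ZMod p)).filter fun x => |x.valMinAbs| ≤ (A : ℤ))
      ((Finset.univ : Finset (ZMod p)).filter fun x => |x.valMinAbs| ≤ (B : ℤ))
    have h1 := card_filter_valMinAbs_le hA1 hA
    have h2 := card_filter_valMinAbs_le hB1 hB
    have : m ≤ _ := (Finset.card_le_card fun x hx => by
        obtain ⟨hx1, hx2⟩ := Finset.mem_filter.1 hx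
        have hx3 := (Finset.mem_filter.1 hx1).2
        simp only [Finset.mem_filter, Finset.mem_product, Finset.mem_univ, true_and]
        exact ⟨hx2, hx3⟩).trans h
    omega
  have hscard : (s : ℝ) ≤ ((p : ℝ) - 1) ^ 2 := by
    have : s ≤ (p - 1) ^ 2 := by
      calc s ≤ ((Finset.univ.erase (0 : ZMod p)) ×ˢ (Finset.univ.erase (0 : ZMod p))).card :=
            Finset.card_le_card fun x hx => by
              have := (Finset.mem_filter.1 hx).2
              simpa using ⟨this.1, this.2.1⟩
        _ = (p - 1) ^ 2 := by
            rw [Finset.card_product, Finset.card_erase_of_mem (Finset.mem_univ _),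
              Finset.card_univ, ZMod.card, pow_two]
    calc (s : ℝ) ≤ ((p - 1 : ℕ) : ℝ) ^ 2 := by exact_mod_cast this
      _ = _ := by rw [Nat.cast_sub hp.one_le, Nat.cast_one]
  have hq : (0 : ℝ) < (p : ℝ) - 1 := by linarith
  have hp0 : (0 : ℝ) < p := by linarith
  have hr4' : (r : ℝ) ≤ 4 * p := by exact_mod_cast hr4
  have hm9' : (m : ℝ) ≤ 9 * A + 3 * B := by exact_mod_cast hm9
  -- The change from p² to (p - 1)² and the discarded r pairs act with opposite signs, and each is
  -- at most 4/p. Multiplied by 4AB with 2B ≤ p, this is at most 8A; with 9A + 3B it explains the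
  -- constant 17.
  have hmain : |(s : ℝ) / ((p : ℝ) - 1) ^ 2 - (s + r) / (p : ℝ) ^ 2| ≤ 4 / (p : ℝ) := by
    have e1 : (r : ℝ) / (p : ℝ) ^ 2 ≤ 4 / p := by
      rw [div_le_div_iff₀ (by positivity) hp0]
      nlinarith
    have e2 : (s : ℝ) / (p : ℝ) ^ 2 ≤ s / ((p : ℝ) - 1) ^ 2 := by
      gcongr
      linarith
    have e3 : (s : ℝ) / ((p : ℝ) - 1) ^ 2 - s / (p : ℝ) ^ 2 ≤ 4 / p := by
      have e4 : (s : ℝ) / ((p : ℝ) - 1) ^ 2 - s / (p : ℝ) ^ 2 =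
          s / ((p : ℝ) - 1) ^ 2 * ((2 * p - 1) / (p : ℝ) ^ 2) := by
        field_simp
        ring
      rw [e4]
      calc _ ≤ 1 * ((2 * p - 1) / (p : ℝ) ^ 2) := by
            refine mul_le_mul_of_nonneg_right ((div_le_one (by positivity)).2 hscard) ?_
            exact div_nonneg (by linarith) (by positivity)
        _ ≤ 4 / p := by
            rw [one_mul, div_le_div_iff₀ (by positivity) hp0]
            nlinarith
    have e0 : 0 ≤ (r : ℝ) / (p : ℝ) ^ 2 := by positivity
    rw [add_div, abs_le]
    constructor <;> linarith
  have hdiff : |4 * A * B / ((p : ℝ) - 1) ^ 2 * s - 4 * A * B / (p : ℝ) ^ 2 * (s + r)| ≤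
      8 * (A : ℝ) := by
    have e : 4 * A * B / ((p : ℝ) - 1) ^ 2 * s - 4 * A * B / (p : ℝ) ^ 2 * (s + r) =
        4 * A * B * ((s : ℝ) / ((p : ℝ) - 1) ^ 2 - (s + r) / (p : ℝ) ^ 2) := by ring
    rw [e, abs_mul, abs_of_nonneg (by positivity)]
    have hBp : (2 : ℝ) * B ≤ p := by exact_mod_cast (show 2 * B ≤ p by omega)
    calc _ ≤ 4 * A * B * (4 / (p : ℝ)) := by gcongr
      _ = 8 * A * (2 * B / p) := by ring
      _ ≤ 8 * A * 1 := by
          gcongr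
          exact (div_le_one hp0).2 hBp
      _ = _ := mul_one _
  rw [hbox, hsr]
  push_cast
  have hm0 : (0 : ℝ) ≤ m := by positivity
  have hA0 : (0 : ℝ) ≤ A := by positivity
  have hB0 : (0 : ℝ) ≤ B := by positivity
  have e : (N : ℝ) + m - 4 * A * B / (p : ℝ) ^ 2 * (s + r) =
      (N - 4 * A * B / ((p : ℝ) - 1) ^ 2 * s) + (m + (4 * A * B / ((p : ℝ) - 1) ^ 2 * s -
        4 * A * B / (p : ℝ) ^ 2 * (s + r))) := by ring
  rw [e]
  refine (abs_add_le _ _).trans (add_le_add_right ((abs_add_le _ _).trans ?_) _)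
  rw [abs_of_nonneg hm0]
  linarith

end Curves

/-! ### Assembling the four bounds -/

theorem min_mul_le_of_factors {x c E F : ℝ} (hc : 0 ≤ c) (h1 : x ≤ c * E) (h2 : x ≤ c * F) :
    x ≤ c * min E F := by
  rw [mul_min_of_nonneg _ _ hc]
  exact le_min h1 h2

/-- The weighted bound is used with exponents (4, 6), and with (6, 4) on the transposed set, giving
both halves of each minimum. The remainder 17(A + B) is absorbed term by term because every factor
involved is at least 1; the largest resulting coefficient is 80 + 17 < 100. -/
theorem abs_boxCount_sub_le_errors {p : ℕ} [Fact p.Prime] {A B : ℕ} (hp3 : 3 < p) (hA1 : 1 ≤ A)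
    (hA : A ≤ (p - 1) / 2) (hB1 : 1 ≤ B) (hB : B ≤ (p - 1) / 2)
    {S : Finset (ZMod p × ZMod p)} (hS : IsoClosed S) :
    |(boxCount S A B : ℝ) - 4 * (A : ℝ) * (B : ℝ) / (p : ℝ) ^ 2 * (S.card : ℝ)| ≤
      100 * min (errorOne A B p * lossFactor p) (errorTwo A B p) := by
  classical
  have hbase := abs_boxCount_sub_le hp3 hA1 hA hB1 hB S
  set T := S.filter IsGeneric with hT
  set N := (T.filter fun x => x.1 ∈ signedBox p A ∧ x.2 ∈ signedBox p B).card with hN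
  have hgen : ∀ x ∈ T, IsGeneric x := fun x hx => (Finset.mem_filter.1 hx).2
  have hinv : ∀ u : (ZMod p)ˣ, ∀ x ∈ T, ((u : ZMod p) ^ 4 * x.1, (u : ZMod p) ^ 6 * x.2) ∈ T := by
    intro u x hx
    obtain ⟨hxS, hx1, hx2, hx3⟩ := Finset.mem_filter.1 hx
    have hu := u.ne_zero
    refine Finset.mem_filter.2 ⟨hS _ _ _ _ hxS (isomorphic_twist hp3 hx3 u),
      mul_ne_zero (pow_ne_zero _ hu) hx1, mul_ne_zero (pow_ne_zero _ hu) hx2, ?_⟩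
    have : 4 * ((u : ZMod p) ^ 4 * x.1) ^ 3 + 27 * ((u : ZMod p) ^ 6 * x.2) ^ 2 =
        (u : ZMod p) ^ 12 * (4 * x.1 ^ 3 + 27 * x.2 ^ 2) := by ring
    simp only [this]
    exact mul_ne_zero (pow_ne_zero _ hu) hx3
  obtain ⟨hab1, hab2⟩ := abs_card_filter_sub_le_errors (k := 4) (l := 6) (by norm_num)
    (by norm_num) (by norm_num) (by norm_num) hp3 hA hB
    (fun x hx => ⟨(hgen x hx).1, (hgen x hx).2.1⟩) hinv
  obtain ⟨hba1, hba2⟩ := abs_card_filter_sub_le_errors (k := 6) (l := 4) (A := B) (B := A)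
    (S := T.map (Equiv.prodComm _ _).toEmbedding) (by norm_num)
    (by norm_num) (by norm_num) (by norm_num) hp3 hB hA
    (fun x hx => by
      obtain ⟨y, hy, rfl⟩ := Finset.mem_map.1 hx
      exact ⟨(hgen y hy).2.1, (hgen y hy).1⟩)
    (fun u x hx => by
      obtain ⟨y, hy, rfl⟩ := Finset.mem_map.1 hx
      exact Finset.mem_map.2 ⟨_, hinv u y hy, rfl⟩)
  have hswap : ((T.map (Equiv.prodComm _ _).toEmbedding).filter
      fun x => x.1 ∈ signedBox p B ∧ x.2 ∈ signedBox p A).card = N := by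
    rw [Finset.filter_map, Finset.card_map, hN]
    refine congrArg Finset.card (Finset.filter_congr fun x _ => ?_)
    exact and_comm
  rw [hswap, Finset.card_map, mul_right_comm (4 : ℝ)] at hba1 hba2
  rw [← hN] at hab1 hab2
  set D := |(N : ℝ) - 4 * A * B / ((p : ℝ) - 1) ^ 2 * T.card|
  have hσ : 1 ≤ sigma p B := (isGreatest_charSumMax p _ B).2 (Set.mem_insert _ _)
  have hρ : 1 ≤ rho p A := (isGreatest_charSumMax p _ A).2 (Set.mem_insert _ _)
  have hp1 : (1 : ℝ) ≤ p := by exact_mod_cast (show 1 ≤ p by omega)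
  have hA1' : (1 : ℝ) ≤ A := by exact_mod_cast hA1
  have hB1' : (1 : ℝ) ≤ B := by exact_mod_cast hB1
  have hlog : 1 ≤ Real.log p := one_le_log hp3
  have hG : 1 ≤ lossFactor p := one_le_lossFactor (by omega)
  have hq : 1 ≤ (p : ℝ) ^ (1 / 4 : ℝ) := Real.one_le_rpow hp1 (by norm_num)
  have ha : 1 ≤ (A : ℝ) ^ (1 / 2 : ℝ) := Real.one_le_rpow hA1' (by norm_num)
  have hb : 1 ≤ (B : ℝ) ^ (1 / 2 : ℝ) := Real.one_le_rpow hB1' (by norm_num)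
  have hAp : (A : ℝ) ≤ p := by exact_mod_cast (show A ≤ p by omega)
  have hBp : (B : ℝ) ≤ p := by exact_mod_cast (show B ≤ p by omega)
  have hAσ : (A : ℝ) ≤ A * sigma p B := le_mul_of_one_le_right (by positivity) hσ
  have hBρ : (B : ℝ) ≤ B * rho p A := le_mul_of_one_le_right (by positivity) hρ
  have hσG : A * sigma p B ≤ A * sigma p B * lossFactor p :=
    le_mul_of_one_le_right (by linarith) hG
  have hρG : B * rho p A ≤ B * rho p A * lossFactor p :=
    le_mul_of_one_le_right (by linarith) hG
  change D ≤ 24 * (A * sigma p B) + _ at hab1 hab2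
  change D ≤ 24 * (B * rho p A) + _ at hba1 hba2
  have hr : 0 ≤ (A : ℝ) ^ (1 / 2 : ℝ) * (B : ℝ) ^ (1 / 2 : ℝ) * (p : ℝ) ^ (1 / 2 : ℝ) *
      lossFactor p := by positivity
  refine min_mul_le_of_factors (by norm_num) ?_ ?_
  · rw [errorOne, min_mul_of_nonneg _ _ (by linarith)]
    refine min_mul_le_of_factors (by norm_num) ?_ ?_
    · have h1 : (B : ℝ) ≤ (A : ℝ) ^ (1 / 2 : ℝ) * B * (p : ℝ) ^ (1 / 4 : ℝ) * lossFactor p :=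
        calc (B : ℝ) = 1 * B * 1 * 1 := by ring
          _ ≤ _ := by gcongr
      linarith
    · have h1 : (A : ℝ) ≤ A * (B : ℝ) ^ (1 / 2 : ℝ) * (p : ℝ) ^ (1 / 4 : ℝ) * lossFactor p :=
        calc (A : ℝ) = A * 1 * 1 * 1 := by ring
          _ ≤ _ := by gcongr
      linarith
  · rw [errorTwo]
    refine min_mul_le_of_factors (by norm_num) ?_ ?_
    · have h1 : (B : ℝ) ≤ (B : ℝ) ^ (1 / 2 : ℝ) * p * Real.log p :=
        calc (B : ℝ) = 1 * B * 1 := by ring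
          _ ≤ _ := by gcongr
      linarith
    · have h1 : (A : ℝ) ≤ (A : ℝ) ^ (1 / 2 : ℝ) * p * Real.log p :=
        calc (A : ℝ) = 1 * A * 1 := by ring
          _ ≤ _ := by gcongr
      linarith

end SmallHeight

end

theorem theorem12 :
    ∃ (c : ℝ) (g : ℕ → ℝ), 0 < c ∧ Tendsto g atTop (𝓝 0) ∧
      ∀ (p : ℕ), p.Prime → 3 < p →
      ∀ (A B : ℕ), 1 ≤ A → A ≤ (p - 1) / 2 → 1 ≤ B → B ≤ (p - 1) / 2 →
      ∀ (S : Finset (ZMod p × ZMod p)), SmallHeight.IsoClosed S →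
        |(SmallHeight.boxCount S A B : ℝ) - 4 * (A : ℝ) * (B : ℝ) / (p : ℝ) ^ 2 * (S.card : ℝ)| ≤
          c * min (SmallHeight.errorOne A B p * (p : ℝ) ^ g p) (SmallHeight.errorTwo A B p) := by
  refine ⟨100, SmallHeight.lossExponent, by norm_num, SmallHeight.tendsto_lossExponent, ?_⟩
  intro p hp hp3 A B hA1 hA hB1 hB S hS
  have : Fact p.Prime := ⟨hp⟩
  rw [SmallHeight.rpow_lossExponent (by omega)]
  exact SmallHeight.abs_boxCount_sub_le_errors hp3 hA1 hA hB1 hB hS
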